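/- **Conventions.** A Boolean function $f\colon\mathbb F_2^n\to\mathbb F_2$ is *homogeneous cubic* if all monomials of its algebraic normal form have degree 3. With $D_{\mathbf a}f(\mathbf x)=f(\mathbf x\oplus\mathbf a)\oplus f(\mathbf x)$, $f$ is *bent* if for all $\mathbf a\ne\mathbf 0$ and $b\in\mathbb F_2$ the equation $D_{\mathbf a}f(\mathbf x)=b$ has $2^{n-1}$ solutions. Functions $f,f'$ are *equivalent* if $f'(\mathbf x)=f(A\mathbf x)\oplus l(\mathbf x)$ for an invertible affine transformation $A$ and an affine function $l$. For $\pi\colon\mathbb F_2^s\to\mathbb F_2^r$ and $\phi\colon\mathbb F_2^s\to\mathbb F_2$ put $h_{\pi,\phi}(\mathbf x,\mathbf y)=\langle\mathbf x,\pi(\mathbf y)\rangle\oplus\phi(\mathbf y)$. A *primary* function $h^{2m}_{pr}$ is any homogeneous cubic bent function of the form $h_{id,\phi}((\mathbf x,\mathbf y)T)$, with $T$ an invertible matrix and $\phi$ a homogeneous cubic function on $\mathbb F_2^m$ all of whose derivatives $D_{\mathbf a}\phi$, $\mathbf a\neq\mathbf 0$, are non-affine. *Modification algorithm.* Let $h$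 be a $d$-homogeneous bent function on $\mathbb F_2^{r+s}$. For an $r$-dimensional subspace $U$ with $D_{\mathbf b}D_{\mathbf a}h=0$ for all $\mathbf a,\mathbf b\in U$, let $A_U$ be the matrix whose first $r$ rows are the Gauss–Jordan (reduced row echelon) basis of $U$ and whose last $s$ rows are the unit vectors at the non-pivot positions, in increasing order; write $h((\mathbf x,\mathbf y)A_U)=h_{\pi,\phi}(\mathbf x,\mathbf y)$ and $T=A_U^{-1}$. Let $\Omega_T(h_{\pi,\phi})$ be the set of all $\omega\colon\mathbb F_2^s\to\mathbb F_2$ such that $h_{\pi,\phi\oplus\omega}((\mathbf x,\mathbf y)T)$ is $d$-homogeneous bent. The output of the algorithm for $h$ consists of all functions $h_{\pi,\phi\oplus\omega}((\mathbf x,\mathbf y)T)$ with $\omega\in\Omega_T(h_{\pi,\phi})$, over all such $U$. *Smith normal form.* $\mathrm{SNF}(f)$ is the multiset of elementary divisors of the $2^{n+1}\times 2^{n+1}$ integer matrix with rows and columns indexed by $\mathbb F_2^n\times\mathbb F_2$, whose entry at row $g$ and column $p$ is $1$ if $p\in G_f+g$ and $0$ otherwise, where $G_f=\{(\mathbf x,f(\mathbf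 x)):\mathbf x\in\mathbb F_2^n\}$. **Theorem.** Let $h_1,\dots,h_7\colon\mathbb F_2^{12}\to\mathbb F_2$ be the functions in the variables $x_0,\dots,x_{11}$ listed below. Then: 1. $h_1,\dots,h_7$ are homogeneous cubic bent functions; 2. they are pairwise inequivalent (so there are at least 7 pairwise inequivalent homogeneous cubic bent functions on $\mathbb F_2^{12}$); 3. none of them is equivalent to any primary function $h^{12}_{pr}$; 4. $h_6$ and $h_7$ belong to the output of the modification algorithm for $h_3$, with $r=s=6$ and $d=3$; 5. $\mathrm{SNF}(h_6)\ne \mathrm{SNF}(h_i)$ for all $i\ne6$, and $\mathrm{SNF}(h_7)\neq \mathrm{SNF}(h_i)$ for all $i\neq 7$. The list: each function is the sum of the monomials shown; three symbols $ijk$ stand for $x_ix_jx_k$, with $a=10$ and $b=11$. - $h_1$: 024 027 02a 02b 034 038 046 049 056 05a 068 06b 078 08a 09a 123 127 135 138 13b 145 149 157 15a 167 16b 179 189 19b 1ab 235 236 237 24b 25b 26b 278 289 29a 346 347 348 389 39a 3ab 457 458 459 49a 4ab 568 569 56a 5ab 679 67a 67b 78a 78b 89b - $h_2$: 024 025 027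 029 02a 02b 034 036 038 03a 046 047 049 04b 056 058 05a 068 069 06b 078 07a 08a 08b 09a 123 125 127 129 135 136 138 13a 13b 145 147 149 14b 157 158 15a 167 169 16b 179 17a 189 18b 19b 1ab 237 239 23a 245 247 249 256 257 25a 26b 278 279 27a 28b 29b 348 34a 34b 356 358 35a 367 368 36b 389 38a 38b 459 45b 467 469 46b 478 479 49a 49b 56a 578 57a 589 58a 5ab 67b 689 68b 69a 69b 79a 7ab 8ab - $h_3$: 023 024 026 027 028 02a 035 038 03b 045 046 048 049 04a 057 05a 067 068 06a 06b 079 089 08a 09b 0ab 124 127 12a 12b 134 135 137 138 139 13b 146 149 156 157 159 15a 15b 168 16b 178 179 17b 18a 19a 19b 234 235 237 239 23b 246 24a 24b 256 26b 278 28a 28b 29a 2ab 345 346 348 34a 357 35b 367 389 39b 3ab 456 457 459 45b 468 478 49a 567 568 56a 579 589 5ab 678 679 67b 68a 69a 789 78a 79b 7ab 89a 89b 9ab - $h_4$: 023 025 026 027 028 029 036 038 03a 045 047 048 049 04a 04b 058 05a 067 069 06a 06b 07a 089 08b 0ab 125 127 129 12b 134 136 137 138 139 13a 147 149 14b 156 158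 159 15a 15b 169 16b 178 17a 17b 18b 19a 234 235 237 239 23b 246 24a 24b 256 26b 278 28a 28b 29a 2ab 345 346 348 34a 357 35b 367 389 39b 3ab 456 457 459 45b 468 478 49a 567 568 56a 579 589 5ab 678 679 67b 68a 69a 789 78a 79b 7ab 89a 89b 9ab - $h_5$: 024 025 027 02a 038 03a 046 047 049 05a 068 069 06b 08a 08b 127 129 135 136 138 13b 149 14b 157 158 15a 16b 179 17a 19b 234 235 239 23a 23b 245 247 249 24b 256 257 25a 279 27a 28b 29a 29b 2ab 345 346 34a 34b 356 358 35a 367 368 36b 38a 38b 3ab 456 457 45b 467 469 46b 478 479 49b 567 568 578 57a 589 58a 678 679 689 68b 69a 69b 789 78a 79a 7ab 89a 89b 8ab 9ab - $h_6$: 027 029 02a 02b 037 038 03a 03b 047 048 049 04b 057 058 059 05a 068 069 06a 06b 078 07b 089 09a 0ab 123 126 127 128 129 12a 134 138 139 13a 13b 145 147 149 14a 14b 156 157 158 15a 15b 167 168 169 16b 237 23a 23b 248 24a 258 25b 269 26a 26b 278 289 28b 29a 29b 347 348 34b 359 35b 367 369 379 37a 389 39a 3ab 456 457 458 459 45b 467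 47b 48a 48b 49a 568 56a 578 579 57b 5ab 678 67a 67b 689 68a 69a 9ab - $h_7$: 027 029 02a 02b 037 038 03a 03b 047 048 049 04b 057 058 059 05a 068 069 06a 06b 078 07b 089 09a 0ab 123 126 127 128 129 12a 134 138 139 13a 13b 145 147 149 14a 14b 156 157 158 15a 15b 167 168 169 16b 237 23a 23b 248 24a 258 25b 269 26a 26b 278 289 28b 29a 29b 347 348 34b 356 359 367 369 36a 379 37a 389 39a 457 458 459 467 46a 47b 48a 48b 49a 4ab 569 56a 578 579 57b 58b 59b 5ab 678 67a 67b 689 8ab -/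

import Mathlib

open scoped Matrix

/-- Boolean functions in `n` variables. -/
abbrev BoolFn (n : ℕ) : Type := (Fin n → ZMod 2) → ZMod 2

/-- `f` is `d`-homogeneous: all monomials `∏ i ∈ S, x i` of its algebraic normal form
`f x = ∑ S, c S * ∏ i ∈ S, x i` (whose coefficients `c S` are determined by `f`) have degree `d`. -/
def IsHomogeneousFn {n : ℕ} (d : ℕ) (f : BoolFn n) : Prop :=
  ∃ c : Finset (Fin n) → ZMod 2,
    (∀ x, f x = ∑ S : Finset (Fin n), c S * ∏ i ∈ S, x i) ∧
    ∀ S, c S ≠ 0 → S.card = d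

/-- The first-order derivative `D_a f`. -/
def derivFn {n : ℕ} (a : Fin n → ZMod 2) (f : BoolFn n) : BoolFn n :=
  fun x => f (x + a) + f x

/-- `f` is bent: for `a ≠ 0`, the equation `D_a f (x) = b` has `2 ^ (n - 1)` solutions. -/
def IsBent {n : ℕ} (f : BoolFn n) : Prop :=
  ∀ a : Fin n → ZMod 2, a ≠ 0 → ∀ b : ZMod 2,
    (Finset.univ.filter fun x => derivFn a f x = b).card = 2 ^ (n - 1)

/-- `f` is an affine function `x ↦ ⟨a, x⟩ + b`. -/
def IsAffineFn {n : ℕ} (f : BoolFn n) : Prop :=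
  ∃ (a : Fin n → ZMod 2) (b : ZMod 2), ∀ x, f x = a ⬝ᵥ x + b

/-- Equivalence of Boolean functions: `f' x = f (A x) + l x` with `A` an invertible affine
transformation and `l` an affine function. -/
def EquivalentFn {n : ℕ} (f f' : BoolFn n) : Prop :=
  ∃ (A : (Fin n → ZMod 2) ≃ᵃ[ZMod 2] (Fin n → ZMod 2)) (l : BoolFn n),
    IsAffineFn l ∧ ∀ x, f' x = f (A x) + l x

/-- The Maiorana-McFarland function `f_{π,φ}(x, y) = ⟨x, π y⟩ + φ y`. -/
def mmFn {r s : ℕ} (π : (Fin s → ZMod 2) → (Fin r → ZMod 2)) (φ : BoolFn s) :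
    (Fin r → ZMod 2) × (Fin s → ZMod 2) → ZMod 2 :=
  fun z => z.1 ⬝ᵥ π z.2 + φ z.2

/-- `h` is a primary homogeneous cubic bent function in `2 * m` variables:
`h = f_{id,φ} ∘ T` is homogeneous cubic bent, where `T` is linear and invertible and `φ` is
homogeneous cubic without affine derivatives on `𝔽₂^m`. -/
def IsPrimary (m : ℕ) (h : BoolFn (2 * m)) : Prop :=
  IsHomogeneousFn 3 h ∧ IsBent h ∧
  ∃ φ : BoolFn m, IsHomogeneousFn 3 φ ∧ (∀ a, a ≠ 0 → ¬ IsAffineFn (derivFn a φ)) ∧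
    ∃ T : (Fin (2 * m) → ZMod 2) ≃ₗ[ZMod 2] (Fin m → ZMod 2) × (Fin m → ZMod 2),
      ∀ z, h z = mmFn id φ (T z)

/-- `U` is an `M`-subspace of `f`: the second-order derivatives `D_{a,b} f` with `a, b ∈ U`
vanish identically. -/
def IsMSubspace {n : ℕ} (f : BoolFn n) (U : Submodule (ZMod 2) (Fin n → ZMod 2)) : Prop :=
  ∀ a ∈ U, ∀ b ∈ U, ∀ x, derivFn b (derivFn a f) x = 0

/-- The rows of `B` are in reduced row echelon form with pivot columns `p` (no zero rows). -/
def IsGaussJordan {r n : ℕ} (B : Matrix (Fin r) (Fin n) (ZMod 2)) (p : Fin r → Fin n) : Prop :=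
  StrictMono p ∧ (∀ i j, B i (p j) = if i = j then 1 else 0) ∧ ∀ i, ∀ k < p i, B i k = 0

/-- `A` is the linear transformation `A_U`, that is `A (x, y) = x B + y C`: the rows of `B` are
the Gauss-Jordan basis of `U`, and the rows of `C` are the unit vectors at the non-pivot positions
(the Gauss-Jordan basis of a complement of `U`). -/
def IsAdaptedMap {r s n : ℕ} (U : Submodule (ZMod 2) (Fin n → ZMod 2))
    (A : ((Fin r → ZMod 2) × (Fin s → ZMod 2)) ≃ₗ[ZMod 2] (Fin n → ZMod 2)) : Prop :=
  ∃ (B : Matrix (Fin r) (Fin n) (ZMod 2)) (p : Fin r → Fin n) (q : Fin s → Fin n),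
    IsGaussJordan B p ∧ Submodule.span (ZMod 2) (Set.range B) = U ∧
    StrictMono q ∧ Set.range q = (Set.range p)ᶜ ∧
    ∀ x y, A (x, y) = x ᵥ* B + ∑ j, y j • (Pi.single (q j) 1 : Fin n → ZMod 2)

/-- `Ω_T(h_{π,φ})`: all `ω` on `𝔽₂^s` such that `h_{π,φ+ω} ∘ T` is `d`-homogeneous bent. -/
def omegaSet {r s n : ℕ} (d : ℕ)
    (T : (Fin n → ZMod 2) ≃ₗ[ZMod 2] (Fin r → ZMod 2) × (Fin s → ZMod 2))
    (π : (Fin s → ZMod 2) → (Fin r → ZMod 2)) (φ : BoolFn s) : Set (BoolFn s) :=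
  {ω | IsHomogeneousFn d (fun z => mmFn π (φ + ω) (T z)) ∧
    IsBent (fun z => mmFn π (φ + ω) (T z))}

/-- The output of the modification algorithm for the input `h`: for each `r`-dimensional
`M`-subspace `U` of `h`, write `h ∘ A_U = h_{π,φ}` and collect the functions `h_{π,φ+ω} ∘ T`,
where `T = A_U⁻¹` and `ω ∈ Ω_T(h_{π,φ})`. -/
def newFromOld {n : ℕ} (r s d : ℕ) (h : BoolFn n) : Set (BoolFn n) :=
  {g | ∃ U : Submodule (ZMod 2) (Fin n → ZMod 2),
    Module.finrank (ZMod 2) U = r ∧ IsMSubspace h U ∧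
    ∃ A : ((Fin r → ZMod 2) × (Fin s → ZMod 2)) ≃ₗ[ZMod 2] (Fin n → ZMod 2),
      IsAdaptedMap U A ∧
      ∃ (π : (Fin s → ZMod 2) → (Fin r → ZMod 2)) (φ : BoolFn s),
        (∀ w, h (A w) = mmFn π φ w) ∧
        ∃ ω ∈ omegaSet d A.symm π φ, ∀ z, g z = mmFn π (φ + ω) (A.symm z)}

/-- The graph `G_f` of `f`, a subset of the additive group `𝔽₂^n × 𝔽₂`. -/
def graphFn {n : ℕ} (f : BoolFn n) : Set ((Fin n → ZMod 2) × ZMod 2) :=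
  Set.range fun x => (x, f x)

/-- The incidence matrix of the development of `S ⊆ G`: the lines (rows) are the translates `S + g`,
the points (columns) are the elements of `G`. -/
noncomputable def devMatrix {G : Type*} [AddGroup G] (S : Set G) : Matrix G G ℤ :=
  Matrix.of fun g p => Set.indicator ((fun a => a + g) '' S) 1 p

/-- The multiset `D` consists of the diagonal entries of a Smith normal form of the square integral
matrix `M`: there are nonnegative `d_1 ∣ d_2 ∣ ⋯` and unimodular `P`, `Q` with
`P M Q = diag(d_1, d_2, …)`. -/
def HasSmithNormalForm {ι : Type*} [Fintype ι] [DecidableEq ι] (M : Matrix ι ι ℤ)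
    (D : Multiset ℕ) : Prop :=
  ∃ (e : ι ≃ Fin (Fintype.card ι)) (d : Fin (Fintype.card ι) → ℕ) (P Q : Matrix ι ι ℤ),
    (∀ i j, i ≤ j → d i ∣ d j) ∧ IsUnit P.det ∧ IsUnit Q.det ∧
    P * M * Q = Matrix.diagonal (fun i => (d (e i) : ℤ)) ∧
    D = Finset.univ.val.map d

/-- `SNF(f)`: the multiset of elementary divisors of the incidence matrix of the development of the
graph of `f`. -/
noncomputable def snf {n : ℕ} (f : BoolFn n) : Multiset ℕ :=
  Classical.epsilon (HasSmithNormalForm (devMatrix (graphFn f)))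

/-- The sum of the cubic monomials `x_i x_j x_k`, for `(i, j, k)` in the list. -/
def cubicOf {n : ℕ} (L : List (Fin n × Fin n × Fin n)) : BoolFn n :=
  fun x => (L.map fun t => x t.1 * x t.2.1 * x t.2.2).sum

/-- The function `h_1` in 12 variables. -/
def h12_1 : BoolFn 12 := cubicOf [
  (0,2,4), (0,2,7), (0,2,10), (0,2,11), (0,3,4), (0,3,8), (0,4,6), (0,4,9), (0,5,6), (0,5,10),
  (0,6,8), (0,6,11), (0,7,8), (0,8,10), (0,9,10), (1,2,3), (1,2,7), (1,3,5), (1,3,8), (1,3,11),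
  (1,4,5), (1,4,9), (1,5,7), (1,5,10), (1,6,7), (1,6,11), (1,7,9), (1,8,9), (1,9,11), (1,10,11),
  (2,3,5), (2,3,6), (2,3,7), (2,4,11), (2,5,11), (2,6,11), (2,7,8), (2,8,9), (2,9,10), (3,4,6),
  (3,4,7), (3,4,8), (3,8,9), (3,9,10), (3,10,11), (4,5,7), (4,5,8), (4,5,9), (4,9,10),
  (4,10,11), (5,6,8), (5,6,9), (5,6,10), (5,10,11), (6,7,9), (6,7,10), (6,7,11), (7,8,10),
  (7,8,11), (8,9,11)]

/-- The function `h_2` in 12 variables. -/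
def h12_2 : BoolFn 12 := cubicOf [
  (0,2,4), (0,2,5), (0,2,7), (0,2,9), (0,2,10), (0,2,11), (0,3,4), (0,3,6), (0,3,8), (0,3,10),
  (0,4,6), (0,4,7), (0,4,9), (0,4,11), (0,5,6), (0,5,8), (0,5,10), (0,6,8), (0,6,9), (0,6,11),
  (0,7,8), (0,7,10), (0,8,10), (0,8,11), (0,9,10), (1,2,3), (1,2,5), (1,2,7), (1,2,9), (1,3,5),
  (1,3,6), (1,3,8), (1,3,10), (1,3,11), (1,4,5), (1,4,7), (1,4,9), (1,4,11), (1,5,7), (1,5,8),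
  (1,5,10), (1,6,7), (1,6,9), (1,6,11), (1,7,9), (1,7,10), (1,8,9), (1,8,11), (1,9,11),
  (1,10,11), (2,3,7), (2,3,9), (2,3,10), (2,4,5), (2,4,7), (2,4,9), (2,5,6), (2,5,7), (2,5,10),
  (2,6,11), (2,7,8), (2,7,9), (2,7,10), (2,8,11), (2,9,11), (3,4,8), (3,4,10), (3,4,11),
  (3,5,6), (3,5,8), (3,5,10), (3,6,7), (3,6,8), (3,6,11), (3,8,9), (3,8,10), (3,8,11), (4,5,9),
  (4,5,11), (4,6,7), (4,6,9), (4,6,11), (4,7,8), (4,7,9), (4,9,10), (4,9,11), (5,6,10), (5,7,8),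
  (5,7,10), (5,8,9), (5,8,10), (5,10,11), (6,7,11), (6,8,9), (6,8,11), (6,9,10), (6,9,11),
  (7,9,10), (7,10,11), (8,10,11)]

/-- The function `h_3` in 12 variables. -/
def h12_3 : BoolFn 12 := cubicOf [
  (0,2,3), (0,2,4), (0,2,6), (0,2,7), (0,2,8), (0,2,10), (0,3,5), (0,3,8), (0,3,11), (0,4,5),
  (0,4,6), (0,4,8), (0,4,9), (0,4,10), (0,5,7), (0,5,10), (0,6,7), (0,6,8), (0,6,10), (0,6,11),
  (0,7,9), (0,8,9), (0,8,10), (0,9,11), (0,10,11), (1,2,4), (1,2,7), (1,2,10), (1,2,11),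
  (1,3,4), (1,3,5), (1,3,7), (1,3,8), (1,3,9), (1,3,11), (1,4,6), (1,4,9), (1,5,6), (1,5,7),
  (1,5,9), (1,5,10), (1,5,11), (1,6,8), (1,6,11), (1,7,8), (1,7,9), (1,7,11), (1,8,10),
  (1,9,10), (1,9,11), (2,3,4), (2,3,5), (2,3,7), (2,3,9), (2,3,11), (2,4,6), (2,4,10), (2,4,11),
  (2,5,6), (2,6,11), (2,7,8), (2,8,10), (2,8,11), (2,9,10), (2,10,11), (3,4,5), (3,4,6),
  (3,4,8), (3,4,10), (3,5,7), (3,5,11), (3,6,7), (3,8,9), (3,9,11), (3,10,11), (4,5,6), (4,5,7),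
  (4,5,9), (4,5,11), (4,6,8), (4,7,8), (4,9,10), (5,6,7), (5,6,8), (5,6,10), (5,7,9), (5,8,9),
  (5,10,11), (6,7,8), (6,7,9), (6,7,11), (6,8,10), (6,9,10), (7,8,9), (7,8,10), (7,9,11),
  (7,10,11), (8,9,10), (8,9,11), (9,10,11)]

/-- The function `h_4` in 12 variables. -/
def h12_4 : BoolFn 12 := cubicOf [
  (0,2,3), (0,2,5), (0,2,6), (0,2,7), (0,2,8), (0,2,9), (0,3,6), (0,3,8), (0,3,10), (0,4,5),
  (0,4,7), (0,4,8), (0,4,9), (0,4,10), (0,4,11), (0,5,8), (0,5,10), (0,6,7), (0,6,9), (0,6,10),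
  (0,6,11), (0,7,10), (0,8,9), (0,8,11), (0,10,11), (1,2,5), (1,2,7), (1,2,9), (1,2,11),
  (1,3,4), (1,3,6), (1,3,7), (1,3,8), (1,3,9), (1,3,10), (1,4,7), (1,4,9), (1,4,11), (1,5,6),
  (1,5,8), (1,5,9), (1,5,10), (1,5,11), (1,6,9), (1,6,11), (1,7,8), (1,7,10), (1,7,11),
  (1,8,11), (1,9,10), (2,3,4), (2,3,5), (2,3,7), (2,3,9), (2,3,11), (2,4,6), (2,4,10), (2,4,11),
  (2,5,6), (2,6,11), (2,7,8), (2,8,10), (2,8,11), (2,9,10), (2,10,11), (3,4,5), (3,4,6),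
  (3,4,8), (3,4,10), (3,5,7), (3,5,11), (3,6,7), (3,8,9), (3,9,11), (3,10,11), (4,5,6), (4,5,7),
  (4,5,9), (4,5,11), (4,6,8), (4,7,8), (4,9,10), (5,6,7), (5,6,8), (5,6,10), (5,7,9), (5,8,9),
  (5,10,11), (6,7,8), (6,7,9), (6,7,11), (6,8,10), (6,9,10), (7,8,9), (7,8,10), (7,9,11),
  (7,10,11), (8,9,10), (8,9,11), (9,10,11)]

/-- The function `h_5` in 12 variables. -/
def h12_5 : BoolFn 12 := cubicOf [
  (0,2,4), (0,2,5), (0,2,7), (0,2,10), (0,3,8), (0,3,10), (0,4,6), (0,4,7), (0,4,9), (0,5,10),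
  (0,6,8), (0,6,9), (0,6,11), (0,8,10), (0,8,11), (1,2,7), (1,2,9), (1,3,5), (1,3,6), (1,3,8),
  (1,3,11), (1,4,9), (1,4,11), (1,5,7), (1,5,8), (1,5,10), (1,6,11), (1,7,9), (1,7,10),
  (1,9,11), (2,3,4), (2,3,5), (2,3,9), (2,3,10), (2,3,11), (2,4,5), (2,4,7), (2,4,9), (2,4,11),
  (2,5,6), (2,5,7), (2,5,10), (2,7,9), (2,7,10), (2,8,11), (2,9,10), (2,9,11), (2,10,11),
  (3,4,5), (3,4,6), (3,4,10), (3,4,11), (3,5,6), (3,5,8), (3,5,10), (3,6,7), (3,6,8), (3,6,11),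
  (3,8,10), (3,8,11), (3,10,11), (4,5,6), (4,5,7), (4,5,11), (4,6,7), (4,6,9), (4,6,11),
  (4,7,8), (4,7,9), (4,9,11), (5,6,7), (5,6,8), (5,7,8), (5,7,10), (5,8,9), (5,8,10), (6,7,8),
  (6,7,9), (6,8,9), (6,8,11), (6,9,10), (6,9,11), (7,8,9), (7,8,10), (7,9,10), (7,10,11),
  (8,9,10), (8,9,11), (8,10,11), (9,10,11)]

/-- The function `h_6` in 12 variables. -/
def h12_6 : BoolFn 12 := cubicOf [
  (0,2,7), (0,2,9), (0,2,10), (0,2,11), (0,3,7), (0,3,8), (0,3,10), (0,3,11), (0,4,7), (0,4,8),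
  (0,4,9), (0,4,11), (0,5,7), (0,5,8), (0,5,9), (0,5,10), (0,6,8), (0,6,9), (0,6,10), (0,6,11),
  (0,7,8), (0,7,11), (0,8,9), (0,9,10), (0,10,11), (1,2,3), (1,2,6), (1,2,7), (1,2,8), (1,2,9),
  (1,2,10), (1,3,4), (1,3,8), (1,3,9), (1,3,10), (1,3,11), (1,4,5), (1,4,7), (1,4,9), (1,4,10),
  (1,4,11), (1,5,6), (1,5,7), (1,5,8), (1,5,10), (1,5,11), (1,6,7), (1,6,8), (1,6,9), (1,6,11),
  (2,3,7), (2,3,10), (2,3,11), (2,4,8), (2,4,10), (2,5,8), (2,5,11), (2,6,9), (2,6,10),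
  (2,6,11), (2,7,8), (2,8,9), (2,8,11), (2,9,10), (2,9,11), (3,4,7), (3,4,8), (3,4,11), (3,5,9),
  (3,5,11), (3,6,7), (3,6,9), (3,7,9), (3,7,10), (3,8,9), (3,9,10), (3,10,11), (4,5,6), (4,5,7),
  (4,5,8), (4,5,9), (4,5,11), (4,6,7), (4,7,11), (4,8,10), (4,8,11), (4,9,10), (5,6,8),
  (5,6,10), (5,7,8), (5,7,9), (5,7,11), (5,10,11), (6,7,8), (6,7,10), (6,7,11), (6,8,9),
  (6,8,10), (6,9,10), (9,10,11)]

/-- The function `h_7` in 12 variables. -/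
def h12_7 : BoolFn 12 := cubicOf [
  (0,2,7), (0,2,9), (0,2,10), (0,2,11), (0,3,7), (0,3,8), (0,3,10), (0,3,11), (0,4,7), (0,4,8),
  (0,4,9), (0,4,11), (0,5,7), (0,5,8), (0,5,9), (0,5,10), (0,6,8), (0,6,9), (0,6,10), (0,6,11),
  (0,7,8), (0,7,11), (0,8,9), (0,9,10), (0,10,11), (1,2,3), (1,2,6), (1,2,7), (1,2,8), (1,2,9),
  (1,2,10), (1,3,4), (1,3,8), (1,3,9), (1,3,10), (1,3,11), (1,4,5), (1,4,7), (1,4,9), (1,4,10),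
  (1,4,11), (1,5,6), (1,5,7), (1,5,8), (1,5,10), (1,5,11), (1,6,7), (1,6,8), (1,6,9), (1,6,11),
  (2,3,7), (2,3,10), (2,3,11), (2,4,8), (2,4,10), (2,5,8), (2,5,11), (2,6,9), (2,6,10),
  (2,6,11), (2,7,8), (2,8,9), (2,8,11), (2,9,10), (2,9,11), (3,4,7), (3,4,8), (3,4,11), (3,5,6),
  (3,5,9), (3,6,7), (3,6,9), (3,6,10), (3,7,9), (3,7,10), (3,8,9), (3,9,10), (4,5,7), (4,5,8),
  (4,5,9), (4,6,7), (4,6,10), (4,7,11), (4,8,10), (4,8,11), (4,9,10), (4,10,11), (5,6,9),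
  (5,6,10), (5,7,8), (5,7,9), (5,7,11), (5,8,11), (5,9,11), (5,10,11), (6,7,8), (6,7,10),
  (6,7,11), (6,8,9), (8,10,11)]

/-- The family of the seven functions: `h12 0, …, h12 6` are `h_1, …, h_7`. -/
def h12 : Fin 7 → BoolFn 12 :=
  ![h12_1, h12_2, h12_3, h12_4, h12_5, h12_6, h12_7]

/-!
A Boolean function on `𝔽₂ⁿ` is stored as one natural number whose digits are its values, so that
adding functions is `^^^`, multiplying them is `&&&`, translating them is a sequence of exchanges of
digits, and the weight is the residue modulo the base minus one. Bentness is the condition that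
the derivatives in all nonzero directions have weight `2 ^ (n - 1)`, which the kernel can then
evaluate.

*Primary functions.* The derivative of `⟨x, y⟩ + φ y` along a direction in `x` is linear, so at
least `2 ^ m` directions have vanishing third derivatives. The set of these directions is carried
along by equivalences, and it is smaller for each `h_i`.

*Modification.* `h_3`, `h_6` and `h_7` have the same derivatives along a common six-dimensional
`M`-subspace, hence differ by a function constant along it, that is, by a function of `y`.

*Smith normal forms.* The elementary divisors determine the order of the row module of the incidence
matrix modulo `q`, which is the module spanned by the translates of the indicator of the graph. Its
order is computed by elimination over `ZMod (2 ^ k)`. For `q = 4` the logarithms to base two are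
`186, 170, 175, 148, 248, 171, 171`, and for `q = 8` those of `h_6` and `h_7` are `610` and `590`.
Hence all seven Smith normal forms differ. As they are invariant under equivalence, the functions
are pairwise inequivalent.
-/

theorem xor_add_two_mul_and (a b : ℕ) : (a ^^^ b) + 2 * (a &&& b) = a + b := by
  induction a using Nat.strong_induction_on generalizing b with
  | _ a ih =>
    rcases Nat.eq_zero_or_pos a with rfl | ha
    · simp
    have half := ih (a / 2) (Nat.div_lt_self ha one_lt_two) (b / 2)
    rw [← Nat.xor_div_two, ← Nat.and_div_two] at half
    have xor_parity : (a ^^^ b) % 2 = (a + b) % 2 := Nat.xor_mod_two_eq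
    have and_parity : (a &&& b) % 2 = a % 2 * (b % 2) := by
      rw [Nat.and_mod_two_pow (n := 1)]
      rcases Nat.mod_two_eq_zero_or_one a with h | h <;>
        rcases Nat.mod_two_eq_zero_or_one b with h' | h' <;> simp [h, h']
    rcases Nat.mod_two_eq_zero_or_one a with h | h <;>
      rcases Nat.mod_two_eq_zero_or_one b with h' | h' <;> simp only [h, h'] at and_parity <;> omega

theorem xor_le_add (a b : ℕ) : a ^^^ b ≤ a + b :=
  le_of_le_of_eq (Nat.le_add_right _ _) (xor_add_two_mul_and a b)

theorem xor_two_pow_of_testBit_eq_false {j i : ℕ} (h : j.testBit i = false) :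
    j ^^^ 2 ^ i = j + 2 ^ i := by
  simpa [Nat.and_two_pow, h] using xor_add_two_mul_and j (2 ^ i)

theorem xor_two_pow_add_of_testBit_eq_true {j i : ℕ} (h : j.testBit i = true) :
    (j ^^^ 2 ^ i) + 2 ^ i = j := by
  have := xor_add_two_mul_and j (2 ^ i)
  rw [Nat.and_two_pow, h, Bool.toNat_true] at this
  omega

theorem xor_two_pow_lt_two_pow_iff {n i : ℕ} (hi : i < n) (j : ℕ) :
    j ^^^ 2 ^ i < 2 ^ n ↔ j < 2 ^ n := by
  have hpow : 2 ^ i < 2 ^ n := Nat.pow_lt_pow_right one_lt_two hi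
  refine ⟨fun h => ?_, fun h => Nat.xor_lt_two_pow h hpow⟩
  simpa using Nat.xor_lt_two_pow h hpow

theorem testBit_eq_decide_le_mod (j i : ℕ) : j.testBit i = decide (2 ^ i ≤ j % 2 ^ (i + 1)) := by
  have := Nat.mod_lt j (Nat.two_pow_pos i)
  rw [Nat.testBit_eq_decide_div_mod_eq, Nat.mod_pow_succ, decide_eq_decide]
  rcases Nat.mod_two_eq_zero_or_one (j / 2 ^ i) with h | h
  · simpa [h] using this
  · simp [h]

theorem mul_add_lt_mul_iff {w k : ℕ} (hk : k < w) (j a : ℕ) : w * j + k < w * a ↔ j < a := by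
  rw [mul_comm w a, ← Nat.div_lt_iff_lt_mul (Nat.zero_lt_of_lt hk),
    Nat.mul_add_div (Nat.zero_lt_of_lt hk), Nat.div_eq_of_lt hk, add_zero]

/-- The natural number with base-`2 ^ w` digits `c 0, …, c (N - 1)`, when these are `< 2 ^ w`. -/
def pack (w N : ℕ) (c : ℕ → ℕ) : ℕ := ∑ j ∈ Finset.range N, c j * 2 ^ (w * j)

section Pack

variable {w N : ℕ} {c d : ℕ → ℕ}

theorem pack_lt (hc : ∀ j, c j < 2 ^ w) (N : ℕ) : pack w N c < 2 ^ (w * N) := by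
  induction N with
  | zero => simp [pack]
  | succ N ih =>
    rw [pack, Finset.sum_range_succ, ← pack, Nat.mul_succ, pow_add]
    have : (c N + 1) * 2 ^ (w * N) ≤ 2 ^ w * 2 ^ (w * N) := Nat.mul_le_mul_right _ (hc N)
    nlinarith

theorem testBit_pack (hc : ∀ j, c j < 2 ^ w) (N j : ℕ) {k : ℕ} (hk : k < w) :
    (pack w N c).testBit (w * j + k) = (decide (j < N) && (c j).testBit k) := by
  induction N with
  | zero => simp [pack]
  | succ N ih =>
    rw [pack, Finset.sum_range_succ, ← pack, add_comm, mul_comm (c N),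
      Nat.testBit_two_pow_mul_add _ (pack_lt hc N)]
    rcases lt_trichotomy j N with hj | rfl | hj
    · have : w * (j + 1) ≤ w * N := Nat.mul_le_mul_left w hj
      rw [if_pos (by rw [Nat.mul_succ] at this; omega), ih]
      simp [hj, hj.trans (Nat.lt_succ_self N)]
    · simp
    · have hle : w * (N + 1) ≤ w * j := Nat.mul_le_mul_left w hj
      rw [Nat.mul_succ] at hle
      rw [if_neg (by omega), Nat.testBit_lt_two_pow
        ((hc N).trans_le (Nat.pow_le_pow_right two_pos (by omega)))]
      simp [Nat.not_lt.2 hj]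

theorem eq_pack_of_testBit (hw : 0 < w) (hc : ∀ j, c j < 2 ^ w) {v : ℕ}
    (h : ∀ j k, k < w → v.testBit (w * j + k) = (decide (j < N) && (c j).testBit k)) :
    v = pack w N c := by
  refine Nat.eq_of_testBit_eq fun i => ?_
  rw [← Nat.div_add_mod i w, h _ _ (Nat.mod_lt _ hw), testBit_pack hc _ _ (Nat.mod_lt _ hw)]

theorem pack_xor (hw : 0 < w) (hc : ∀ j, c j < 2 ^ w) (hd : ∀ j, d j < 2 ^ w) (N : ℕ) :
    pack w N c ^^^ pack w N d = pack w N fun j => c j ^^^ d j := by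
  refine eq_pack_of_testBit hw (fun j => Nat.xor_lt_two_pow (hc j) (hd j)) fun j k hk => ?_
  rw [Nat.testBit_xor, Nat.testBit_xor, testBit_pack hc _ _ hk, testBit_pack hd _ _ hk,
    Bool.and_xor_distrib_left]

theorem pack_and (hw : 0 < w) (hc : ∀ j, c j < 2 ^ w) (hd : ∀ j, d j < 2 ^ w) (N : ℕ) :
    pack w N c &&& pack w N d = pack w N fun j => c j &&& d j := by
  refine eq_pack_of_testBit hw (fun j => Nat.and_lt_two_pow _ (hd j)) fun j k hk => ?_
  rw [Nat.testBit_and, Nat.testBit_and, testBit_pack hc _ _ hk, testBit_pack hd _ _ hk]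
  cases decide (j < N) <;> simp

theorem pack_add (w N : ℕ) (c d : ℕ → ℕ) :
    pack w N c + pack w N d = pack w N fun j => c j + d j := by
  simp only [pack, add_mul, Finset.sum_add_distrib]

theorem mul_pack (w N m : ℕ) (c : ℕ → ℕ) : m * pack w N c = pack w N fun j => m * c j := by
  simp only [pack, Finset.mul_sum, mul_assoc]

theorem pack_congr (h : ∀ j < N, c j = d j) : pack w N c = pack w N d :=
  Finset.sum_congr rfl fun j hj => by rw [h j (Finset.mem_range.1 hj)]

theorem pack_modEq_sum (w N : ℕ) (c : ℕ → ℕ) :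
    pack w N c ≡ ∑ j ∈ Finset.range N, c j [MOD 2 ^ w - 1] := by
  have base : 2 ^ w ≡ 1 [MOD 2 ^ w - 1] :=
    ((Nat.modEq_iff_dvd' Nat.one_le_two_pow).2 dvd_rfl).symm
  refine Nat.ModEq.sum fun j _ => ?_
  simpa [pow_mul] using (base.pow j).mul_left (c j)

/-- The digit of index `j` of `v` in base `2 ^ w`. -/
def digit (w v j : ℕ) : ℕ := (v >>> (w * j)) &&& (2 ^ w - 1)

theorem digit_pack (hc : ∀ j, c j < 2 ^ w) {j : ℕ} (hj : j < N) : digit w (pack w N c) j = c j := by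
  refine Nat.eq_of_testBit_eq fun k => ?_
  rw [digit, Nat.testBit_and, Nat.testBit_two_pow_sub_one, Nat.testBit_shiftRight]
  by_cases hk : k < w
  · simp [testBit_pack hc _ _ hk, hj, hk]
  · simp [hk, Nat.testBit_lt_two_pow
      ((hc j).trans_le (Nat.pow_le_pow_right two_pos (not_lt.1 hk)))]

/-- The number all of whose `N` digits in base `2 ^ w` are `1`. -/
def repunit (w N : ℕ) : ℕ := (2 ^ (w * N) - 1) / (2 ^ w - 1)

theorem repunit_eq_pack (hw : 0 < w) (N : ℕ) : repunit w N = pack w N fun _ => 1 := by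
  rw [repunit, pow_mul, ← Nat.geomSum_eq (Nat.le_self_pow hw.ne' 2), pack]
  simp only [pow_mul, one_mul]

theorem repunit_mul_eq_pack (hw : 0 < w) (N m : ℕ) : repunit w N * m = pack w N fun _ => m := by
  rw [repunit_eq_pack hw, mul_comm, mul_pack]
  simp only [mul_one]

theorem pack_and_repunit_mul (hc : ∀ j, c j < 2 ^ w) {m : ℕ} (hw : 0 < w) (hm : m < 2 ^ w) (N : ℕ) :
    pack w N c &&& repunit w N * m = pack w N fun j => c j &&& m := by
  rw [repunit_mul_eq_pack hw, pack_and hw hc fun _ => hm]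

/-- The packed indicator, with digits `0` and `2 ^ w - 1`, of the indices `j < 2 ^ n` whose bit `i`
is not set. -/
def lowMask (w n i : ℕ) : ℕ :=
  (2 ^ (w * 2 ^ i) - 1) * repunit (w * 2 ^ (i + 1)) (2 ^ (n - i - 1))

theorem lowMask_digit_lt (w i j : ℕ) : (bif j.testBit i then 0 else 2 ^ w - 1) < 2 ^ w := by
  have := Nat.two_pow_pos w
  cases j.testBit i <;> simp

theorem lowMask_eq_pack (hw : 0 < w) {n i : ℕ} (hi : i < n) :
    lowMask w n i = pack w (2 ^ n) fun j => bif j.testBit i then 0 else 2 ^ w - 1 := by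
  refine eq_pack_of_testBit hw (lowMask_digit_lt w i) fun j k hk => ?_
  set b := 2 ^ (i + 1) with hb
  have hbpos : 0 < b := Nat.two_pow_pos _
  have hlt (_ : ℕ) : 2 ^ (w * 2 ^ i) - 1 < 2 ^ (w * b) :=
    (Nat.sub_lt (Nat.two_pow_pos _) one_pos).trans_le
      (Nat.pow_le_pow_right two_pos
        (Nat.mul_le_mul_left _ (Nat.pow_le_pow_right two_pos i.le_succ)))
  have block : w * j + k = w * b * (j / b) + (w * (j % b) + k) := by
    conv_lhs => rw [← Nat.div_add_mod j b]
    ring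
  have hoffset : w * (j % b) + k < w * b := (mul_add_lt_mul_iff hk _ _).2 (Nat.mod_lt _ hbpos)
  have hblock : j / b < 2 ^ (n - i - 1) ↔ j < 2 ^ n := by
    rw [Nat.div_lt_iff_lt_mul hbpos, hb, ← pow_add, show n - i - 1 + (i + 1) = n by omega]
  have hlow : w * (j % b) + k < w * 2 ^ i ↔ j.testBit i = false := by
    rw [mul_add_lt_mul_iff hk, testBit_eq_decide_le_mod, decide_eq_false_iff_not, not_le, ← hb]
  rw [lowMask, ← hb, mul_comm, repunit_mul_eq_pack (Nat.mul_pos hw hbpos), block,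
    testBit_pack hlt _ _ hoffset, Nat.testBit_two_pow_sub_one]
  simp only [hblock, hlow]
  cases j.testBit i <;> simp [hk]

theorem bif_testBit_lt (hc : ∀ j, c j < 2 ^ w) (i j : ℕ) :
    (bif j.testBit i then 0 else c j) < 2 ^ w := by
  have := Nat.two_pow_pos w
  cases j.testBit i <;> simp [hc]

theorem pack_shiftRight_and_lowMask (hw : 0 < w) (hc : ∀ j, c j < 2 ^ w) {n i : ℕ} (hi : i < n) :
    (pack w (2 ^ n) c >>> (w * 2 ^ i)) &&& lowMask w n i =
      pack w (2 ^ n) fun j => bif j.testBit i then 0 else c (j ^^^ 2 ^ i) := by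
  refine eq_pack_of_testBit hw (bif_testBit_lt (fun j => hc _) i) fun j k hk => ?_
  rw [Nat.testBit_and, Nat.testBit_shiftRight, lowMask_eq_pack hw hi,
    testBit_pack (lowMask_digit_lt w i) _ _ hk, ← add_assoc, ← Nat.mul_add, add_comm (2 ^ i),
    testBit_pack hc _ _ hk]
  cases hj : j.testBit i with
  | true => simp
  | false =>
    have hxor := xor_two_pow_of_testBit_eq_false hj
    have hlt := xor_two_pow_lt_two_pow_iff hi j
    rw [hxor] at hlt
    by_cases hjn : j < 2 ^ n <;> simp [hlt, hjn, hxor, Nat.testBit_two_pow_sub_one, hk]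

theorem testBit_sub_two_pow {i j : ℕ} (hle : 2 ^ i ≤ j) :
    (j - 2 ^ i).testBit i = !j.testBit i := by
  conv_rhs => rw [← Nat.add_sub_cancel' hle, Nat.testBit_two_pow_add_eq, Bool.not_not]

theorem pack_and_lowMask_shiftLeft (hw : 0 < w) (hc : ∀ j, c j < 2 ^ w) {n i : ℕ} (hi : i < n) :
    (pack w (2 ^ n) c &&& lowMask w n i) <<< (w * 2 ^ i) =
      pack w (2 ^ n) fun j => bif j.testBit i then c (j ^^^ 2 ^ i) else 0 := by
  have hlt (j : ℕ) : (bif j.testBit i then c (j ^^^ 2 ^ i) else 0) < 2 ^ w := by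
    cases j.testBit i <;> simp [hc]
  refine eq_pack_of_testBit hw hlt fun j k hk => ?_
  have hle : w * 2 ^ i ≤ w * j + k ↔ 2 ^ i ≤ j :=
    not_iff_not.1 (by simpa only [not_le] using mul_add_lt_mul_iff hk j (2 ^ i))
  rw [Nat.testBit_shiftLeft, lowMask_eq_pack hw hi, pack_and hw hc (lowMask_digit_lt w i)]
  by_cases h : 2 ^ i ≤ j
  · have hdigit (j : ℕ) : (c j &&& bif j.testBit i then 0 else 2 ^ w - 1) < 2 ^ w :=
      Nat.and_lt_two_pow _ (lowMask_digit_lt w i j)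
    rw [Nat.sub_add_comm (Nat.mul_le_mul_left w h), ← Nat.mul_sub, testBit_pack hdigit _ _ hk,
      testBit_sub_two_pow h]
    cases hj : j.testBit i with
    | false => simp
    | true =>
      rw [Nat.sub_eq_of_eq_add (xor_two_pow_add_of_testBit_eq_true hj).symm]
      simp [hle, h, xor_two_pow_lt_two_pow_iff hi, hk]
  · have : j.testBit i = false := Nat.testBit_lt_two_pow (not_le.1 h)
    simp [hle, h, this]

/-- Exchanges the digits of `v` whose indices differ in bit `i`. -/
def swapBit (w n i v : ℕ) : ℕ :=
  ((v >>> (w * 2 ^ i)) &&& lowMask w n i) + ((v &&& lowMask w n i) <<< (w * 2 ^ i))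

theorem swapBit_pack (hw : 0 < w) (hc : ∀ j, c j < 2 ^ w) {n i : ℕ} (hi : i < n) :
    swapBit w n i (pack w (2 ^ n) c) = pack w (2 ^ n) fun j => c (j ^^^ 2 ^ i) := by
  rw [swapBit, pack_shiftRight_and_lowMask hw hc hi, pack_and_lowMask_shiftLeft hw hc hi, pack_add]
  refine pack_congr fun j _ => ?_
  cases j.testBit i <;> simp

end Pack

/-- The point of `𝔽₂ⁿ` whose coordinates are the binary digits of `j`. -/
def point (n j : ℕ) : Fin n → ZMod 2 := fun i => bif j.testBit i then 1 else 0

/-- The number whose binary digits are the coordinates of `x`. -/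
def code {n : ℕ} (x : Fin n → ZMod 2) : ℕ := Nat.ofBits fun i => decide (x i = 1)

theorem point_xor (n j l : ℕ) : point n (j ^^^ l) = point n j + point n l := by
  ext i
  simp only [point, Nat.testBit_xor, Pi.add_apply]
  cases j.testBit i <;> cases l.testBit i <;> rfl

theorem point_two_pow {n : ℕ} (i : Fin n) : point n (2 ^ (i : ℕ)) = Pi.single i 1 := by
  ext j
  rcases eq_or_ne j i with rfl | h
  · simp [point]
  · simp [point, h, Fin.val_inj, h.symm]

theorem point_zero (n : ℕ) : point n 0 = 0 := by
  ext i
  simp [point]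

theorem code_lt {n : ℕ} (x : Fin n → ZMod 2) : code x < 2 ^ n := Nat.ofBits_lt_two_pow _

theorem testBit_code {n : ℕ} (x : Fin n → ZMod 2) (i : Fin n) :
    (code x).testBit i = decide (x i = 1) := Nat.testBit_ofBits_lt _ _ i.2

theorem point_code {n : ℕ} (x : Fin n → ZMod 2) : point n (code x) = x := by
  ext i
  rw [point, testBit_code]
  generalize x i = s
  decide +revert

theorem code_point {n j : ℕ} (h : j < 2 ^ n) : code (point n j) = j := by
  refine Nat.eq_of_testBit_eq fun i => ?_
  by_cases hi : i < n
  · rw [show i = ((⟨i, hi⟩ : Fin n) : ℕ) from rfl, testBit_code, point]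
    cases j.testBit i <;> simp
  · have hpow : 2 ^ n ≤ 2 ^ i := Nat.pow_le_pow_right two_pos (not_lt.1 hi)
    rw [Nat.testBit_lt_two_pow ((code_lt _).trans_le hpow),
      Nat.testBit_lt_two_pow (h.trans_le hpow)]

/-- Indexing of the points of `𝔽₂ⁿ` by `0, …, 2 ^ n - 1`. -/
def pointEquiv (n : ℕ) : Fin (2 ^ n) ≃ (Fin n → ZMod 2) where
  toFun j := point n j
  invFun x := ⟨code x, code_lt x⟩
  left_inv j := Fin.ext (code_point j.2)
  right_inv x := point_code x

/-- The values of a function on `𝔽₂ⁿ`, packed as the digits of one natural number. -/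
def table (w : ℕ) {n m : ℕ} (e : (Fin n → ZMod 2) → ZMod m) : ℕ :=
  pack w (2 ^ n) fun j => (e (point n j)).val

section Table

variable {w n m : ℕ} (hm : m ≤ 2 ^ w)

theorem table_zero (w n m : ℕ) : table w (0 : (Fin n → ZMod 2) → ZMod m) = 0 := by
  simp [table, pack]

theorem table_modEq_sum (w : ℕ) (e : (Fin n → ZMod 2) → ZMod m) :
    table w e ≡ ∑ x, (e x).val [MOD 2 ^ w - 1] := by
  rw [← (pointEquiv n).sum_comp fun x => (e x).val]
  exact (pack_modEq_sum w (2 ^ n) _).trans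
    (by rw [Finset.sum_range fun j => (e (point n j)).val]; rfl)

variable [NeZero m]

include hm in
theorem val_lt_two_pow (s : ZMod m) : s.val < 2 ^ w := (ZMod.val_lt s).trans_le hm

include hm in
theorem digit_table (e : (Fin n → ZMod 2) → ZMod m) (x : Fin n → ZMod 2) :
    digit w (table w e) (code x) = (e x).val := by
  rw [table, digit_pack (fun j => val_lt_two_pow hm _) (code_lt x), point_code]

include hm in
theorem table_injective : Function.Injective (table w : ((Fin n → ZMod 2) → ZMod m) → ℕ) := by
  intro e e' h
  funext x
  exact ZMod.val_injective m (by rw [← digit_table hm, ← digit_table hm, h])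

include hm in
theorem swapBit_table (hw : 0 < w) (e : (Fin n → ZMod 2) → ZMod m) (i : Fin n) :
    swapBit w n i (table w e) = table w fun x => e (x + Pi.single i 1) := by
  rw [table, swapBit_pack hw (fun j => val_lt_two_pow hm _) i.2]
  simp only [table, point_xor, point_two_pow]

/-- The value `k n`. The case distinction makes the kernel evaluate `n` to a numeral before it is
substituted into `k`. -/
def force {α : Type} (n : ℕ) (k : ℕ → α) : α :=
  match n with
  | 0 => k 0
  | n + 1 => k n.succ

omit [NeZero m] in
theorem force_eq {α : Type} (n : ℕ) (k : ℕ → α) : force n k = k n := by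
  cases n <;> rfl

/-- The table of `x ↦ e (x + a)` from the table of `e`, where the coordinates of `a` are the first
`i` binary digits of `S`. -/
def translateTable (w n S : ℕ) : ℕ → ℕ → ℕ
  | 0, T => T
  | i + 1, T => force (bif S.testBit i then swapBit w n i T else T) (translateTable w n S i)

theorem point_mod_two_pow_succ {i : ℕ} (hi : i < n) (S : ℕ) :
    point n (S % 2 ^ (i + 1)) =
      point n (S % 2 ^ i) + if S.testBit i then Pi.single ⟨i, hi⟩ 1 else 0 := by
  ext j
  simp only [point, Pi.add_apply, Nat.testBit_mod_two_pow]
  rcases lt_trichotomy (j : ℕ) i with hj | rfl | hj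
  · have hne : j ≠ ⟨i, hi⟩ := fun h => hj.ne (congrArg Fin.val h)
    cases S.testBit i <;> simp [hj, hj.trans i.lt_succ_self, hne]
  · cases S.testBit j <;> simp
  · have hne : j ≠ ⟨i, hi⟩ := fun h => hj.ne' (congrArg Fin.val h)
    cases S.testBit i <;> simp [hj.not_gt, hne, Nat.not_lt.2 (Nat.succ_le_of_lt hj)]

include hm in
theorem translateTable_table_of_le (hw : 0 < w) (S : ℕ) {i : ℕ} (hi : i ≤ n)
    (e : (Fin n → ZMod 2) → ZMod m) :
    translateTable w n S i (table w e) = table w fun x => e (x + point n (S % 2 ^ i)) := by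
  induction i generalizing e with
  | zero => simp [translateTable, Nat.mod_one, point_zero]
  | succ i ih =>
    rw [translateTable, force_eq, point_mod_two_pow_succ hi]
    cases S.testBit i with
    | false => simpa using ih (Nat.le_of_succ_le hi) e
    | true =>
      have hswap := swapBit_table hm hw e ⟨i, hi⟩
      rw [cond_true, hswap, ih (Nat.le_of_succ_le hi)]
      simp only [if_true, add_assoc]

include hm in
theorem translateTable_table (hw : 0 < w) (e : (Fin n → ZMod 2) → ZMod m) {S : ℕ}
    (hS : S < 2 ^ n) :
    translateTable w n S n (table w e) = table w fun x => e (x + point n S) := by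
  rw [translateTable_table_of_le hm hw S le_rfl, Nat.mod_eq_of_lt hS]

end Table

section BoolTable

variable {w n : ℕ} (hw : 0 < w)

include hw in
theorem table_add (f f' : BoolFn n) : table w (f + f') = table w f ^^^ table w f' := by
  have val_add (s t : ZMod 2) : (s + t).val = s.val ^^^ t.val := by decide +revert
  have hlt (f : BoolFn n) (j : ℕ) : (f (point n j)).val < 2 ^ w :=
    val_lt_two_pow (Nat.le_self_pow hw.ne' 2) _
  simp only [table, Pi.add_apply, val_add, pack_xor hw (hlt f) (hlt f')]

include hw in
theorem table_mul (f f' : BoolFn n) : table w (f * f') = table w f &&& table w f' := by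
  have val_mul (s t : ZMod 2) : (s * t).val = s.val &&& t.val := by decide +revert
  have hlt (f : BoolFn n) (j : ℕ) : (f (point n j)).val < 2 ^ w :=
    val_lt_two_pow (Nat.le_self_pow hw.ne' 2) _
  simp only [table, Pi.mul_apply, val_mul, pack_and hw (hlt f) (hlt f')]

/-- The table of the coordinate function `x ↦ x i`. -/
def varTable (w n i : ℕ) : ℕ := repunit w (2 ^ n) ^^^ (repunit w (2 ^ n) &&& lowMask w n i)

include hw in
theorem repunit_eq_table (n : ℕ) : repunit w (2 ^ n) = table w (1 : BoolFn n) := by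
  rw [repunit_eq_pack hw]
  rfl

include hw in
theorem varTable_eq_table (i : Fin n) : varTable w n i = table w fun x : Fin n → ZMod 2 => x i := by
  have hone : 1 < 2 ^ w := Nat.one_lt_two_pow hw.ne'
  rw [varTable, repunit_eq_pack hw, lowMask_eq_pack hw i.2,
    pack_and hw (fun _ => hone) (lowMask_digit_lt w i),
    pack_xor hw (fun _ => hone) fun _ => Nat.and_lt_two_pow _ (lowMask_digit_lt w i _)]
  refine pack_congr fun j _ => ?_
  simp only [point]
  cases j.testBit i with
  | true => simp [ZMod.val_one]
  | false =>
    rw [cond_false, Nat.and_two_pow_sub_one_eq_mod, Nat.mod_eq_of_lt hone]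
    rfl

/-- The table of `cubicOf L`, as a function of the first `n` of `N` variables. -/
def cubicTable (w N : ℕ) {n : ℕ} : List (Fin n × Fin n × Fin n) → ℕ
  | [] => 0
  | t :: L => force (cubicTable w N L) fun T =>
    (varTable w N t.1 &&& varTable w N t.2.1 &&& varTable w N t.2.2) ^^^ T

include hw in
theorem cubicTable_eq_table {N : ℕ} (h : n ≤ N) (L : List (Fin n × Fin n × Fin n)) :
    cubicTable w N L = table w fun x : Fin N → ZMod 2 => cubicOf L fun i => x (i.castLE h) := by
  induction L with
  | nil => exact (table_zero w N 2).symm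
  | cons t L ih =>
    have hvar (i : Fin n) := varTable_eq_table hw (i.castLE h)
    simp only [Fin.val_castLE] at hvar
    rw [cubicTable, force_eq, ih, hvar, hvar, hvar, ← table_mul hw, ← table_mul hw, ← table_add hw]
    rfl

end BoolTable

theorem isHomogeneousFn_cubicOf {n : ℕ} {L : List (Fin n × Fin n × Fin n)}
    (h : ∀ t ∈ L, t.1 < t.2.1 ∧ t.2.1 < t.2.2) : IsHomogeneousFn 3 (cubicOf L) := by
  let s : Fin n × Fin n × Fin n → Finset (Fin n) := fun t => {t.1, t.2.1, t.2.2}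
  refine ⟨fun S => (L.map fun t => if S = s t then 1 else 0).sum, fun x => ?_, fun S hS => ?_⟩
  · induction L with
    | nil => simp [cubicOf]
    | cons t L ih =>
      obtain ⟨h1, h2⟩ := h t List.mem_cons_self
      have hL : cubicOf (t :: L) x = x t.1 * x t.2.1 * x t.2.2 + cubicOf L x := by simp [cubicOf]
      have hprod : ∏ i ∈ s t, x i = x t.1 * x t.2.1 * x t.2.2 := by
        rw [Finset.prod_insert (by simpa using ⟨h1.ne, (h1.trans h2).ne⟩),
          Finset.prod_insert (by simpa using h2.ne), Finset.prod_singleton, mul_assoc]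
      rw [hL, ih fun u hu => h u (List.mem_cons_of_mem _ hu), ← hprod]
      simp only [List.map_cons, List.sum_cons, add_mul, Finset.sum_add_distrib, ite_mul, one_mul,
        zero_mul, Finset.sum_ite_eq', Finset.mem_univ, if_true]
  · obtain ⟨t, ht, rfl⟩ : ∃ t ∈ L, S = s t := by
      by_contra! hcon
      refine hS (List.sum_eq_zero fun a ha => ?_)
      obtain ⟨t, ht, rfl⟩ := List.mem_map.1 ha
      exact if_neg (hcon t ht)
    obtain ⟨h1, h2⟩ := h t ht
    exact Finset.card_eq_three.2 ⟨_, _, _, h1.ne, (h1.trans h2).ne, h2.ne, rfl⟩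

theorem isHomogeneousFn_cubicOf_of_all {n : ℕ} {L : List (Fin n × Fin n × Fin n)}
    (h : (L.all fun t => Nat.blt t.1 t.2.1 && Nat.blt t.2.1 t.2.2) = true) :
    IsHomogeneousFn 3 (cubicOf L) := by
  simp only [List.all_eq_true, Bool.and_eq_true, Nat.blt_eq] at h
  exact isHomogeneousFn_cubicOf h

theorem isBent_of_card_eq {n : ℕ} {f : BoolFn n}
    (h : ∀ a, a ≠ 0 → (Finset.univ.filter fun x => derivFn a f x = 1).card = 2 ^ (n - 1)) :
    IsBent f := by
  intro a ha b
  obtain rfl | rfl : b = 1 ∨ b = 0 := by decide +revert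
  · exact h a ha
  · obtain ⟨i, -⟩ := Function.ne_iff.1 ha
    have hcard := Finset.card_filter_add_card_filter_not (s := Finset.univ)
      fun x => derivFn a f x = 1
    have hne (s : ZMod 2) : ¬s = 1 ↔ s = 0 := by decide +revert
    simp only [hne, h a ha, Finset.card_univ, Fintype.card_pi, ZMod.card, Finset.prod_const,
      Fintype.card_fin] at hcard
    have hpow : 2 ^ n = 2 ^ (n - 1) * 2 := by rw [← pow_succ, Nat.sub_add_cancel i.pos]
    omega

/-- All translates of the table `T` by points with `i` binary digits satisfy `p`, which is also
given the code of the translation, starting from `S`. -/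
def allTranslates (w n : ℕ) (p : ℕ → ℕ → Bool) : ℕ → ℕ → ℕ → Bool
  | 0, S, T => p S T
  | i + 1, S, T =>
    allTranslates w n p i S T &&
      force (swapBit w n i T) (allTranslates w n p i (S ^^^ 2 ^ i))

section Tables

variable {w n : ℕ} (hw : 0 < w)

include hw in
theorem forall_of_allTranslates {m : ℕ} [NeZero m] (hm : m ≤ 2 ^ w) {p : ℕ → ℕ → Bool}
    (e : (Fin n → ZMod 2) → ZMod m) {i : ℕ} (hi : i ≤ n) {S : ℕ}
    (h : allTranslates w n p i S (table w fun x => e (x + point n S)) = true) {j : ℕ}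
    (hj : j < 2 ^ i) : p (S ^^^ j) (table w fun x => e (x + point n (S ^^^ j))) = true := by
  induction i generalizing S j with
  | zero =>
    obtain rfl : j = 0 := by simpa using hj
    simpa [allTranslates] using h
  | succ i ih =>
    rw [allTranslates, Bool.and_eq_true, force_eq] at h
    cases hbit : j.testBit i with
    | false =>
      refine ih (Nat.le_of_succ_le hi) h.1 (Nat.lt_pow_two_of_testBit j fun l hl => ?_)
      obtain rfl | hl := hl.eq_or_lt
      · exact hbit
      · exact Nat.testBit_lt_two_pow (hj.trans_le (Nat.pow_le_pow_right two_pos hl))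
    | true =>
      have hswap := swapBit_table hm hw (fun x => e (x + point n S)) ⟨i, hi⟩
      have hlt : j ^^^ 2 ^ i < 2 ^ i := by
        have := xor_two_pow_add_of_testBit_eq_true hbit
        rw [pow_succ] at hj
        omega
      simp only [← point_two_pow, add_assoc, ← point_xor] at hswap
      rw [hswap, Nat.xor_comm (2 ^ i)] at h
      simpa [Nat.xor_assoc, Nat.xor_comm (2 ^ i)] using ih (Nat.le_of_succ_le hi) h.2 hlt

include hw in
theorem table_derivFn (a : Fin n → ZMod 2) (f : BoolFn n) :
    table w (derivFn a f) = table w (fun x => f (x + a)) ^^^ table w f := table_add hw _ f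

theorem table_mod_eq_card (h : n + 1 < w) (f : BoolFn n) :
    table w f % (2 ^ w - 1) = (Finset.univ.filter fun x => f x = 1).card := by
  have hval (s : ZMod 2) : s.val = if s = 1 then 1 else 0 := by decide +revert
  have hcard : (Finset.univ.filter fun x => f x = 1).card < 2 ^ w - 1 := by
    have hle : (Finset.univ.filter fun x => f x = 1).card ≤ 2 ^ n := by
      simpa using Finset.card_le_univ (Finset.univ.filter fun x => f x = 1)
    have hpow : 2 ^ (n + 1 + 1) ≤ 2 ^ w := Nat.pow_le_pow_right two_pos h
    have := Nat.two_pow_pos n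
    rw [pow_succ, pow_succ] at hpow
    omega
  have hmod := table_modEq_sum w f
  simp only [hval, ← Finset.card_filter] at hmod
  rw [hmod, Nat.mod_eq_of_lt hcard]

/-- All derivatives in nonzero directions of the function with table `T` have weight
`2 ^ (n - 1)`. -/
def bentCheck (n T : ℕ) : Bool :=
  allTranslates (n + 2) n
    (fun S U => S.beq 0 || ((U ^^^ T) % (2 ^ (n + 2) - 1)).beq (2 ^ (n - 1))) n 0 T

theorem isBent_of_bentCheck {f : BoolFn n} (h : bentCheck n (table (n + 2) f) = true) :
    IsBent f := by
  have hw : 0 < n + 2 := (n + 1).succ_pos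
  refine isBent_of_card_eq fun a ha => ?_
  have hzero : table (n + 2) f = table (n + 2) fun x => f (x + point n 0) := by
    simp only [point_zero, add_zero]
  have hcode : code a ≠ 0 := fun h0 => ha (by rw [← point_code a, h0, point_zero])
  rw [bentCheck] at h
  nth_rw 2 [hzero] at h
  have hcheck := forall_of_allTranslates hw (Nat.le_self_pow hw.ne' 2) f le_rfl h
    (code_lt a)
  rw [Nat.zero_xor, point_code, ← table_derivFn hw] at hcheck
  rw [← table_mod_eq_card (n + 1).lt_succ_self]
  simpa [hcode] using hcheck

theorem isBent_cubicOf {L : List (Fin n × Fin n × Fin n)}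
    (h : bentCheck n (cubicTable (n + 2) n L) = true) : IsBent (cubicOf L) := by
  rw [cubicTable_eq_table (n + 1).succ_pos le_rfl] at h
  exact isBent_of_bentCheck h

end Tables

theorem derivFn_comm {n : ℕ} (a b : Fin n → ZMod 2) (f : BoolFn n) :
    derivFn a (derivFn b f) = derivFn b (derivFn a f) := by
  ext x
  simp only [derivFn, add_right_comm x a b]
  ring

theorem derivFn_comp_affineEquiv_add {n : ℕ} {f f' l : BoolFn n}
    {A : (Fin n → ZMod 2) ≃ᵃ[ZMod 2] (Fin n → ZMod 2)} (h : ∀ x, f' x = f (A x) + l x)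
    (a x : Fin n → ZMod 2) :
    derivFn a f' x = derivFn (A.linear a) f (A x) + derivFn a l x := by
  have hA : A (x + a) = A x + A.linear a := by
    simpa only [vadd_eq_add, add_comm] using A.map_vadd x a
  rw [derivFn, h, h, hA, derivFn, derivFn, add_add_add_comm]

/-- The third derivatives of `f`, one of them in direction `a`, vanish. The directions with this
property form a linear invariant of `f`, which is large for a primary function. -/
def IsFlat {n : ℕ} (f : BoolFn n) (a : Fin n → ZMod 2) : Prop :=
  ∀ b c x, derivFn c (derivFn b (derivFn a f)) x = 0

theorem IsAffineFn.isFlat {n : ℕ} {l : BoolFn n} (hl : IsAffineFn l) (a : Fin n → ZMod 2) :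
    IsFlat l a := by
  obtain ⟨v, s, hl⟩ := hl
  have hderiv : derivFn a l = fun _ => v ⬝ᵥ a := by
    ext x
    rw [derivFn, hl, hl, dotProduct_add]
    clear hl
    generalize v ⬝ᵥ x = s, v ⬝ᵥ a = t
    decide +revert
  intro b c x
  rw [hderiv]
  simp only [derivFn, CharTwo.add_self_eq_zero]

theorem EquivalentFn.exists_injective_isFlat {n : ℕ} {f h : BoolFn n} (he : EquivalentFn f h) :
    ∃ a : (Fin n → ZMod 2) → (Fin n → ZMod 2), Function.Injective a ∧
      ∀ u, IsFlat h u → IsFlat f (a u) := by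
  obtain ⟨A, l, hl, hf⟩ := he
  refine ⟨A.linear, A.linear.injective, fun u hu b c x => ?_⟩
  have hthird := derivFn_comp_affineEquiv_add (derivFn_comp_affineEquiv_add
    (derivFn_comp_affineEquiv_add hf u) (A.linear.symm b)) (A.linear.symm c) (A.symm x)
  simpa [hu _ _ _, hl.isFlat u _ _ _] using hthird.symm

theorem IsPrimary.exists_injective_isFlat {m : ℕ} {h : BoolFn (2 * m)} (hp : IsPrimary m h) :
    ∃ a : (Fin m → ZMod 2) → (Fin (2 * m) → ZMod 2), Function.Injective a ∧
      ∀ u, IsFlat h (a u) := by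
  obtain ⟨-, -, φ, -, -, T, hT⟩ := hp
  refine ⟨fun u => T.symm (u, 0), fun u v huv => by simpa using huv, fun u b c x => ?_⟩
  have hu : derivFn (T.symm (u, 0)) h = fun x => u ⬝ᵥ (T x).2 := by
    ext x
    simp only [derivFn, hT, mmFn, map_add, LinearEquiv.apply_symm_apply, Prod.fst_add,
      Prod.snd_add, add_zero, id, add_dotProduct]
    rw [add_add_add_comm, CharTwo.add_self_eq_zero, add_zero, add_comm (_ ⬝ᵥ _), add_assoc,
      CharTwo.add_self_eq_zero, add_zero]
  rw [hu]
  simp only [derivFn, map_add, Prod.snd_add, dotProduct_add]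
  generalize u ⬝ᵥ (T x).2 = s, u ⬝ᵥ (T c).2 = t, u ⬝ᵥ (T b).2 = r
  decide +revert

open Classical in
theorem not_equivalentFn_of_isPrimary {m : ℕ} {f h : BoolFn (2 * m)} (hp : IsPrimary m h)
    (hf : (Finset.univ.filter (IsFlat f)).card < 2 ^ m) : ¬EquivalentFn f h := by
  intro he
  obtain ⟨a, ha, haf⟩ := hp.exists_injective_isFlat
  obtain ⟨b, hb, hbf⟩ := he.exists_injective_isFlat
  refine hf.not_ge ?_
  have hcard := Finset.card_le_card_of_injOn (s := Finset.univ)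
    (t := Finset.univ.filter (IsFlat f)) (b ∘ a) (fun u _ => by simpa using hbf _ (haf u))
    (hb.comp ha).injOn
  simpa using hcard

section Tables

variable {w n : ℕ} (hw : 0 < w)

/-- The table of the indicator function of the points where the function with table `T` has the
same value as at `0`. -/
def levelTable (w n T : ℕ) : ℕ := bif T.testBit 0 then T else T ^^^ repunit w (2 ^ n)

include hw in
theorem levelTable_table (f : BoolFn n) :
    levelTable w n (table w f) = table w fun x => f x + (f 0 + 1) := by
  have hbit : (table w f).testBit 0 = (f 0).val.testBit 0 := by
    have hpack := testBit_pack (fun j => val_lt_two_pow (Nat.le_self_pow hw.ne' 2) (f (point n j)))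
      (2 ^ n) 0 hw
    rwa [point_zero, mul_zero, decide_eq_true (Nat.two_pow_pos n), Bool.true_and] at hpack
  rw [levelTable, hbit, repunit_eq_table hw, ← table_add hw]
  obtain hzero | hone : f 0 = 0 ∨ f 0 = 1 := by
    generalize f 0 = s
    decide +revert
  · rw [hzero]
    rfl
  · simp [hone, ZMod.val_one, CharTwo.add_self_eq_zero]

/-- The table of a function which is `1` at the points `a` such that the mixed third derivatives
at `0` in direction `a` and two unit vectors, listed in `L`, vanish. -/
def flatTable (w n T : ℕ) : List (Fin n × Fin n) → ℕ
  | [] => repunit w (2 ^ n)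
  | p :: L =>
    force (swapBit w n p.1 T ^^^ T) (fun T' => levelTable w n (swapBit w n p.2 T' ^^^ T')) &&&
      flatTable w n T L

include hw in
theorem exists_flatTable_eq_table (f : BoolFn n) (L : List (Fin n × Fin n)) :
    ∃ g : BoolFn n, flatTable w n (table w f) L = table w g ∧ ∀ a, IsFlat f a → g a = 1 := by
  have hswap (f : BoolFn n) (i : Fin n) :
      swapBit w n i (table w f) ^^^ table w f = table w (derivFn (Pi.single i 1) f) := by
    rw [table_derivFn hw, swapBit_table (Nat.le_self_pow hw.ne' 2) hw]
  induction L with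
  | nil => exact ⟨1, repunit_eq_table hw n, fun _ _ => rfl⟩
  | cons p L ih =>
    obtain ⟨g, hg, hgf⟩ := ih
    set f₂ := derivFn (Pi.single p.2 1) (derivFn (Pi.single p.1 1) f) with hf₂
    refine ⟨(fun x => f₂ x + (f₂ 0 + 1)) * g, ?_, fun a ha => ?_⟩
    · rw [flatTable, force_eq, hswap, hswap, levelTable_table hw, hg, table_mul hw]
    · have hthird := ha (Pi.single p.1 1) (Pi.single p.2 1) 0
      rw [derivFn_comm _ a, derivFn_comm _ a, ← hf₂, derivFn, zero_add] at hthird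
      rw [Pi.mul_apply, hgf a ha, ← add_assoc, hthird, zero_add, one_mul]

open Classical in
theorem card_isFlat_le (h : n + 1 < w) (f : BoolFn n) (L : List (Fin n × Fin n)) :
    (Finset.univ.filter (IsFlat f)).card ≤ flatTable w n (table w f) L % (2 ^ w - 1) := by
  obtain ⟨g, hg, hgf⟩ := exists_flatTable_eq_table (Nat.zero_lt_of_lt h) f L
  rw [hg, table_mod_eq_card h]
  exact Finset.card_le_card (Finset.monotone_filter_right _ fun a _ => hgf a)

/-- The directions in which all third derivatives of the function with table `T` may vanish, as
counted at the unit vectors, are fewer than `2 ^ m`. -/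
def fewFlatCheck (m T : ℕ) : Bool :=
  flatTable (2 * m + 2) (2 * m) T (List.finRange (2 * m) ×ˢ List.finRange (2 * m)) %
    (2 ^ (2 * m + 2) - 1) < 2 ^ m

theorem not_equivalentFn_cubicOf_of_isPrimary {m : ℕ}
    {L : List (Fin (2 * m) × Fin (2 * m) × Fin (2 * m))}
    (h : fewFlatCheck m (cubicTable (2 * m + 2) (2 * m) L) = true) {f : BoolFn (2 * m)}
    (hf : IsPrimary m f) : ¬EquivalentFn (cubicOf L) f := by
  rw [cubicTable_eq_table (Nat.succ_pos _) le_rfl] at h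
  exact not_equivalentFn_of_isPrimary hf
    ((card_isFlat_le (Nat.lt_succ_self _) _ _).trans_lt (of_decide_eq_true h))

end Tables

theorem derivFn_add_left {n : ℕ} (a b : Fin n → ZMod 2) (f : BoolFn n) (x : Fin n → ZMod 2) :
    derivFn (a + b) f x = derivFn a f (x + b) + derivFn b f x := by
  simp only [derivFn, add_assoc, add_comm b a, CharTwo.add_cancel_left]

theorem derivFn_zero_left {n : ℕ} (f : BoolFn n) (x : Fin n → ZMod 2) : derivFn 0 f x = 0 := by
  rw [derivFn, add_zero, CharTwo.add_self_eq_zero]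

theorem forall_mem_span_zmod_two {E : Type*} [AddCommGroup E] [Module (ZMod 2) E] {s : Set E}
    {P : E → Prop} (hs : ∀ a ∈ s, P a) (h0 : P 0) (hadd : ∀ a b, P a → P b → P (a + b)) :
    ∀ a ∈ Submodule.span (ZMod 2) s, P a := by
  intro a ha
  induction ha using Submodule.span_induction with
  | mem a ha => exact hs a ha
  | zero => exact h0
  | add a b _ _ ha hb => exact hadd a b ha hb
  | smul c a _ ha =>
    obtain rfl | rfl : c = 0 ∨ c = 1 := by decide +revert
    · rwa [zero_smul]
    · rwa [one_smul]

theorem isMSubspace_span {n : ℕ} {f : BoolFn n} {s : Set (Fin n → ZMod 2)}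
    (hs : ∀ a ∈ s, ∀ b ∈ s, ∀ x, derivFn b (derivFn a f) x = 0) :
    IsMSubspace f (Submodule.span (ZMod 2) s) := by
  refine forall_mem_span_zmod_two (fun a ha => ?_) (fun b _ x => ?_) fun a c ha hc b hb x => ?_
  · refine forall_mem_span_zmod_two (hs a ha) (fun x => derivFn_zero_left _ x) ?_
    intro b c hb hc x
    rw [derivFn_add_left, hb, hc, add_zero]
  · rw [derivFn_comm, derivFn_zero_left]
  · rw [derivFn_comm, derivFn_add_left, derivFn_comm, ha b hb, derivFn_comm, hc b hb, add_zero]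

section Modification

variable {r s n : ℕ} {B : Matrix (Fin r) (Fin n) (ZMod 2)}

theorem vecMul_mem_span_range (B : Matrix (Fin r) (Fin n) (ZMod 2)) (x : Fin r → ZMod 2) :
    x ᵥ* B ∈ Submodule.span (ZMod 2) (Set.range B) := by
  rw [Matrix.vecMul_eq_sum]
  exact Submodule.sum_mem _ fun i _ =>
    Submodule.smul_mem _ _ (Submodule.subset_span (Set.mem_range_self i))

theorem IsMSubspace.derivFn_vecMul {f : BoolFn n}
    (hf : IsMSubspace f (Submodule.span (ZMod 2) (Set.range B))) (x : Fin r → ZMod 2)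
    (z : Fin n → ZMod 2) : derivFn (x ᵥ* B) f z = x ⬝ᵥ fun i => derivFn (B i) f z := by
  let D : (Fin r → ZMod 2) →+ ZMod 2 := AddMonoidHom.mk' (fun x => derivFn (x ᵥ* B) f z) <| by
    intro x y
    have hxy := hf _ (vecMul_mem_span_range B x) _ (vecMul_mem_span_range B y) z
    rw [derivFn] at hxy
    rw [Matrix.add_vecMul, derivFn_add_left, CharTwo.add_eq_zero.1 hxy]
  have hsum := (D.toZModLinearMap 2).pi_apply_eq_sum_univ x
  have hsingle (i : Fin r) : (fun j => if i = j then (1 : ZMod 2) else 0) = Pi.single i 1 := by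
    ext j
    simp only [Pi.single_apply, eq_comm]
  simpa [hsingle, D, dotProduct, Matrix.row] using hsum

theorem IsGaussJordan.linearIndependent {p : Fin r → Fin n} (hB : IsGaussJordan B p) :
    LinearIndependent (ZMod 2) B := by
  refine (Fintype.linearIndependent_iff (v := fun i => B i)).2 fun c hc i => ?_
  simpa [Finset.sum_apply, hB.2.1] using congrFun hc (p i)

theorem IsGaussJordan.exists_isAdaptedMap (hn : r + s = n) {p : Fin r → Fin n}
    {q : Fin s → Fin n} (hB : IsGaussJordan B p) (hq : StrictMono q)
    (hqp : Set.range q = (Set.range p)ᶜ) :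
    ∃ A : ((Fin r → ZMod 2) × (Fin s → ZMod 2)) ≃ₗ[ZMod 2] (Fin n → ZMod 2),
      IsAdaptedMap (Submodule.span (ZMod 2) (Set.range B)) A ∧
        ∀ x y, A (x, y) = A (0, y) + x ᵥ* B := by
  let A : ((Fin r → ZMod 2) × (Fin s → ZMod 2)) →ₗ[ZMod 2] (Fin n → ZMod 2) :=
    B.vecMulLinear.coprod (∑ j, (LinearMap.proj j).smulRight (Pi.single (q j) 1))
  have hA (x : Fin r → ZMod 2) (y : Fin s → ZMod 2) :
      A (x, y) = x ᵥ* B + ∑ j, y j • (Pi.single (q j) 1 : Fin n → ZMod 2) := by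
    simp [A, LinearMap.coprod_apply, LinearMap.sum_apply]
  have hne (i : Fin r) (j : Fin s) : p i ≠ q j := fun hij =>
    (hqp ▸ Set.mem_range_self j : q j ∈ (Set.range p)ᶜ) ⟨i, hij⟩
  have hinj : Function.Injective A := by
    rw [injective_iff_map_eq_zero]
    rintro ⟨x, y⟩ hxy
    rw [hA] at hxy
    obtain rfl : x = 0 := by
      ext i
      simpa [Matrix.vecMul, dotProduct, hB.2.1, Finset.sum_apply, hne] using congrFun hxy (p i)
    obtain rfl : y = 0 := by
      ext j
      simpa [Finset.sum_apply, Pi.single_apply, hq.injective.eq_iff] using congrFun hxy (q j)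
    rfl
  have hbij : Function.Bijective A :=
    (Fintype.bijective_iff_injective_and_card A).2 ⟨hinj, by simp [← hn, pow_add]⟩
  refine ⟨.ofBijective A hbij, ⟨B, p, q, hB, rfl, hq, hqp, hA⟩, fun x y => ?_⟩
  rw [LinearEquiv.ofBijective_apply, LinearEquiv.ofBijective_apply, hA, hA 0,
    Matrix.zero_vecMul, zero_add, add_comm]

-- `f + g` is constant along the span of `B`, so in the coordinates `(x, y)` it depends only on `y`.
theorem mem_newFromOld (hn : r + s = n) {d : ℕ} {f g : BoolFn n} (hg : IsHomogeneousFn d g)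
    (hg' : IsBent g) {p : Fin r → Fin n} {q : Fin s → Fin n} (hB : IsGaussJordan B p)
    (hq : StrictMono q) (hqp : Set.range q = (Set.range p)ᶜ)
    (hf : ∀ i j, derivFn (B j) (derivFn (B i) f) = 0)
    (hfg : ∀ i, derivFn (B i) f = derivFn (B i) g) : g ∈ newFromOld r s d f := by
  obtain ⟨A, hA, hAB⟩ := hB.exists_isAdaptedMap hn hq hqp
  have hM {e : BoolFn n} (he : ∀ i, derivFn (B i) e = derivFn (B i) f) :
      IsMSubspace e (Submodule.span (ZMod 2) (Set.range B)) := by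
    refine isMSubspace_span ?_
    rintro _ ⟨i, rfl⟩ _ ⟨j, rfl⟩ x
    rw [he, hf, Pi.zero_apply]
  let π (y : Fin s → ZMod 2) (i : Fin r) : ZMod 2 := derivFn (B i) f (A (0, y))
  have hmm {e : BoolFn n} (he : ∀ i, derivFn (B i) e = derivFn (B i) f)
      (w : (Fin r → ZMod 2) × (Fin s → ZMod 2)) : e (A w) = mmFn π (fun y => e (A (0, y))) w := by
    obtain ⟨x, y⟩ := w
    have hπ := (hM he).derivFn_vecMul x (A (0, y))
    simp only [he] at hπ
    rw [mmFn, ← hπ, derivFn, ← hAB, add_assoc, CharTwo.add_self_eq_zero, add_zero]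
  have hfg' (y : Fin s → ZMod 2) : g (A (0, y)) = f (A (0, y)) + (f (A (0, y)) + g (A (0, y))) :=
    (CharTwo.add_cancel_left _ _).symm
  have hgA : (fun z => mmFn π ((fun y => f (A (0, y))) + fun y => f (A (0, y)) + g (A (0, y)))
      (A.symm z)) = g := by
    ext z
    have hz := hmm (fun i => (hfg i).symm) (A.symm z)
    rw [LinearEquiv.apply_symm_apply] at hz
    rw [hz]
    exact congrArg _ (hfg' _).symm
  refine ⟨_, ?_, hM fun _ => rfl, A, hA, π, _, hmm fun _ => rfl, _, ⟨?_, ?_⟩,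
    fun z => (congrFun hgA z).symm⟩
  · rw [finrank_span_eq_card hB.linearIndependent, Fintype.card_fin]
  · rwa [hgA]
  · rwa [hgA]

end Modification

section Tables

variable {w n : ℕ}

/-- The derivatives of the functions with tables `T` and `U` in the directions with codes in `l`
coincide, and their derivatives in these directions vanish. -/
def modificationCheck (w n T U : ℕ) (l : List ℕ) : Bool :=
  let deriv T S := translateTable w n S n T ^^^ T
  l.all fun S => deriv T S == deriv U S && l.all fun S' => deriv (deriv T S) S' == 0

theorem cubicOf_mem_newFromOld {r s d : ℕ} {L M : List (Fin n × Fin n × Fin n)} (hn : r + s = n)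
    (hd : IsHomogeneousFn d (cubicOf M)) (hbent : IsBent (cubicOf M)) {b : Fin r → Fin (2 ^ n)}
    {p : Fin r → Fin n} {q : Fin s → Fin n}
    (hB : IsGaussJordan (Matrix.of fun i => point n (b i)) p) (hq : StrictMono q)
    (hqp : Set.range q = (Set.range p)ᶜ) (hw : 0 < w)
    (h : modificationCheck w n (cubicTable w n L) (cubicTable w n M)
      (List.ofFn fun i => (b i : ℕ)) = true) :
    cubicOf M ∈ newFromOld r s d (cubicOf L) := by
  have hm : 2 ≤ 2 ^ w := Nat.le_self_pow hw.ne' 2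
  have hderiv (i : Fin r) (f : BoolFn n) :
      translateTable w n (b i) n (table w f) ^^^ table w f =
        table w (derivFn (point n (b i)) f) := by
    rw [table_derivFn hw, translateTable_table hm hw _ (b i).2]
  rw [cubicTable_eq_table hw le_rfl, cubicTable_eq_table hw le_rfl] at h
  simp only [modificationCheck, List.all_eq_true, Bool.and_eq_true, beq_iff_eq,
    List.forall_mem_ofFn_iff, Fin.castLE_rfl, id, hderiv] at h
  refine mem_newFromOld hn hd hbent hB hq hqp (fun i j => table_injective hm ?_) fun i =>
    table_injective hm (h i).1
  rw [table_zero]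
  exact (h i).2 j

end Tables

/-- Equivalence of square matrices under invertible row and column operations: `N = P * M * Q` with
`P` and `Q` invertible. -/
def UnimodularEquivalent {ι R : Type*} [Fintype ι] [DecidableEq ι] [CommRing R]
    (M N : Matrix ι ι R) : Prop :=
  ∃ P Q : Matrix ι ι R, IsUnit P ∧ IsUnit Q ∧ P * M * Q = N

namespace UnimodularEquivalent

section CommRing

variable {ι κ R : Type*} [Fintype ι] [DecidableEq ι] [Fintype κ] [DecidableEq κ] [CommRing R]

theorem refl (M : Matrix ι ι R) : UnimodularEquivalent M M :=
  ⟨1, 1, isUnit_one, isUnit_one, by rw [Matrix.one_mul, Matrix.mul_one]⟩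

theorem trans {M N K : Matrix ι ι R} :
    UnimodularEquivalent M N → UnimodularEquivalent N K → UnimodularEquivalent M K := by
  rintro ⟨P, Q, hP, hQ, rfl⟩ ⟨P', Q', hP', hQ', rfl⟩
  exact ⟨P' * P, Q * Q', hP'.mul hP, hQ.mul hQ', by simp only [Matrix.mul_assoc]⟩

theorem symm {M N : Matrix ι ι R} (h : UnimodularEquivalent M N) : UnimodularEquivalent N M := by
  obtain ⟨P, Q, ⟨P, rfl⟩, ⟨Q, rfl⟩, rfl⟩ := h
  exact ⟨↑P⁻¹, ↑Q⁻¹, P⁻¹.isUnit, Q⁻¹.isUnit, by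
    rw [Matrix.mul_assoc P.1, Units.inv_mul_cancel_left, Units.mul_inv_cancel_right]⟩

theorem mul_left {P : Matrix ι ι R} (hP : IsUnit P) (M : Matrix ι ι R) :
    UnimodularEquivalent M (P * M) :=
  ⟨P, 1, hP, isUnit_one, Matrix.mul_one _⟩

theorem mul_right {Q : Matrix ι ι R} (hQ : IsUnit Q) (M : Matrix ι ι R) :
    UnimodularEquivalent M (M * Q) :=
  ⟨1, Q, isUnit_one, hQ, by rw [Matrix.one_mul]⟩

theorem transpose {M N : Matrix ι ι R} (h : UnimodularEquivalent M N) :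
    UnimodularEquivalent M.transpose N.transpose := by
  obtain ⟨P, Q, hP, hQ, rfl⟩ := h
  exact ⟨Q.transpose, P.transpose, (Matrix.isUnit_transpose Q).2 hQ,
    (Matrix.isUnit_transpose P).2 hP, by simp only [Matrix.transpose_mul, Matrix.mul_assoc]⟩

theorem smul {M N : Matrix ι ι R} (h : UnimodularEquivalent M N) (a : R) :
    UnimodularEquivalent (a • M) (a • N) := by
  obtain ⟨P, Q, hP, hQ, rfl⟩ := h
  exact ⟨P, Q, hP, hQ, by rw [Matrix.mul_smul, Matrix.smul_mul]⟩

theorem map {S : Type*} [CommRing S] {M N : Matrix ι ι R} (h : UnimodularEquivalent M N)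
    (f : R →+* S) : UnimodularEquivalent (M.map f) (N.map f) := by
  obtain ⟨P, Q, hP, hQ, rfl⟩ := h
  exact ⟨P.map f, Q.map f, hP.map f.mapMatrix, hQ.map f.mapMatrix, by simp only [Matrix.map_mul]⟩

theorem submatrix {M N : Matrix ι ι R} (h : UnimodularEquivalent M N) (e : κ ≃ ι) :
    UnimodularEquivalent (M.submatrix e e) (N.submatrix e e) := by
  obtain ⟨P, Q, hP, hQ, rfl⟩ := h
  exact ⟨P.submatrix e e, Q.submatrix e e, (Matrix.isUnit_submatrix_equiv e e).2 hP,
    (Matrix.isUnit_submatrix_equiv e e).2 hQ, by simp only [Matrix.submatrix_mul_equiv]⟩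

theorem fromBlocks {A : Matrix κ κ R} {M N : Matrix ι ι R} (h : UnimodularEquivalent M N) :
    UnimodularEquivalent (.fromBlocks A 0 0 M) (.fromBlocks A 0 0 N) := by
  obtain ⟨P, Q, hP, hQ, rfl⟩ := h
  refine ⟨.fromBlocks 1 0 0 P, .fromBlocks 1 0 0 Q,
    Matrix.isUnit_fromBlocks_zero₂₁.2 ⟨isUnit_one, hP⟩,
    Matrix.isUnit_fromBlocks_zero₂₁.2 ⟨isUnit_one, hQ⟩, ?_⟩
  simp [Matrix.fromBlocks_multiply]

theorem fromBlocks_clear (A : Matrix κ κ R) (B : Matrix κ ι R) (C : Matrix ι κ R)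
    (D : Matrix ι ι R) :
    UnimodularEquivalent (.fromBlocks A (A * B) (C * A) D)
      (.fromBlocks A 0 0 (D - C * A * B)) := by
  refine ⟨.fromBlocks 1 0 (-C) 1, .fromBlocks 1 (-B) 0 1,
    Matrix.isUnit_fromBlocks_zero₁₂.2 ⟨isUnit_one, isUnit_one⟩,
    Matrix.isUnit_fromBlocks_zero₂₁.2 ⟨isUnit_one, isUnit_one⟩, ?_⟩
  simp [Matrix.fromBlocks_multiply, Matrix.mul_assoc, sub_eq_neg_add]

theorem submatrix_submatrix (M : Matrix ι ι R) (e f : ι ≃ ι) :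
    UnimodularEquivalent M (M.submatrix e f) := by
  have hunit (e₁ e₂ : ι ≃ ι) : IsUnit ((1 : Matrix ι ι R).submatrix e₁ e₂) :=
    (Matrix.isUnit_submatrix_equiv e₁ e₂).2 isUnit_one
  refine ⟨Matrix.submatrix 1 e (Equiv.refl ι), Matrix.submatrix 1 (Equiv.refl ι) f, hunit _ _,
    hunit _ _, ?_⟩
  ext i j
  simp [Matrix.mul_apply, Matrix.one_apply]

end CommRing

/-- `N i j` is a nonzero entry of `N` than which no nonzero entry of any equivalent matrix is
smaller. -/
def IsMinimalEntry {ι R : Type*} [Fintype ι] [DecidableEq ι] [EuclideanDomain R]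
    (N : Matrix ι ι R) (i j : ι) : Prop :=
  N i j ≠ 0 ∧ ∀ N', UnimodularEquivalent N N' → ∀ i' j', N' i' j' ≠ 0 →
    ¬EuclideanDomain.r (N' i' j') (N i j)

section EuclideanDomain

variable {ι κ R : Type*} [Fintype ι] [DecidableEq ι] [Fintype κ] [DecidableEq κ]
  [EuclideanDomain R]

theorem IsMinimalEntry.of_equivalent {N N' : Matrix ι ι R} {i j i' j' : ι}
    (h : IsMinimalEntry N i j) (hN : UnimodularEquivalent N N') (heq : N' i' j' = N i j) :
    IsMinimalEntry N' i' j' :=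
  ⟨heq ▸ h.1, fun N'' h' => heq ▸ h.2 N'' (hN.trans h')⟩

theorem exists_isMinimalEntry {M : Matrix ι ι R} (hM : M ≠ 0) (k : ι) :
    ∃ N, UnimodularEquivalent M N ∧ IsMinimalEntry N k k := by
  obtain ⟨i₀, j₀, h₀⟩ : ∃ i j, M i j ≠ 0 := by
    by_contra! h
    exact hM (Matrix.ext h)
  obtain ⟨a, ⟨⟨N, i, j⟩, ⟨hN, hne⟩, rfl⟩, hmin⟩ := EuclideanDomain.r_wellFounded.has_min
    ((fun p : Matrix ι ι R × ι × ι => p.1 p.2.1 p.2.2) ''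
      {p | UnimodularEquivalent M p.1 ∧ p.1 p.2.1 p.2.2 ≠ 0}) ⟨_, (M, i₀, j₀), ⟨refl M, h₀⟩, rfl⟩
  have hij : IsMinimalEntry N i j :=
    ⟨hne, fun N' h' i' j' hne' => hmin _ ⟨(N', i', j'), ⟨hN.trans h', hne'⟩, rfl⟩⟩
  have hswap := submatrix_submatrix N (Equiv.swap k i) (Equiv.swap k j)
  exact ⟨_, hN.trans hswap, hij.of_equivalent hswap (by simp)⟩

theorem IsMinimalEntry.dvd_row {N : Matrix ι ι R} {i k : ι} (h : IsMinimalEntry N i k) (j : ι) :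
    N i k ∣ N i j := by
  classical
  rcases eq_or_ne k j with rfl | hkj
  · exact dvd_rfl
  by_contra hdvd
  have hunit : IsUnit (Matrix.transvection k j (-(N i j / N i k))) := by
    rw [Matrix.isUnit_iff_isUnit_det, Matrix.det_transvection_of_ne _ _ hkj]
    exact isUnit_one
  have hmod : (N * Matrix.transvection k j (-(N i j / N i k))) i j = N i j % N i k := by
    rw [Matrix.mul_transvection_apply_same, EuclideanDomain.mod_eq_sub_mul_div]
    ring
  refine h.2 _ (mul_right hunit N) i j ?_ (hmod ▸ EuclideanDomain.remainder_lt _ h.1)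
  rwa [hmod, Ne, EuclideanDomain.mod_eq_zero]

theorem IsMinimalEntry.transpose {N : Matrix ι ι R} {i j : ι} (h : IsMinimalEntry N i j) :
    IsMinimalEntry N.transpose j i :=
  ⟨h.1, fun _ h' i' j' => h.2 _ h'.transpose j' i'⟩

theorem IsMinimalEntry.dvd_col {N : Matrix ι ι R} {k j : ι} (h : IsMinimalEntry N k j) (i : ι) :
    N k j ∣ N i j :=
  h.transpose.dvd_row i

theorem IsMinimalEntry.exists_equivalent_fromBlocks {N : Matrix (Unit ⊕ κ) (Unit ⊕ κ) R}
    (h : IsMinimalEntry N (.inl ()) (.inl ())) :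
    ∃ D : Matrix κ κ R, UnimodularEquivalent N (.fromBlocks N.toBlocks₁₁ 0 0 D) := by
  choose r hr using fun j => h.dvd_row (.inr j)
  choose c hc using fun i => h.dvd_col (.inr i)
  have hN₁₂ : N.toBlocks₁₂ = N.toBlocks₁₁ * Matrix.replicateRow Unit r := by
    ext i j
    simp [Matrix.mul_apply, Matrix.toBlocks₁₁, Matrix.toBlocks₁₂, hr]
  have hN₂₁ : N.toBlocks₂₁ = Matrix.replicateCol Unit c * N.toBlocks₁₁ := by
    ext i j
    simp [Matrix.mul_apply, Matrix.toBlocks₁₁, Matrix.toBlocks₂₁, hc, mul_comm]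
  rw [← Matrix.fromBlocks_toBlocks N, hN₁₂, hN₂₁, Matrix.toBlocks_fromBlocks₁₁]
  exact ⟨_, fromBlocks_clear ..⟩

theorem IsMinimalEntry.dvd_of_fromBlocks {A : Matrix Unit Unit R} {D : Matrix κ κ R}
    (h : IsMinimalEntry (.fromBlocks A 0 0 D) (.inl ()) (.inl ())) (i j : κ) :
    A () () ∣ D i j := by
  have hunit : IsUnit (Matrix.transvection (.inl () : Unit ⊕ κ) (.inr i) (1 : R)) := by
    rw [Matrix.isUnit_iff_isUnit_det, Matrix.det_transvection_of_ne _ _ Sum.inl_ne_inr]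
    exact isUnit_one
  have hadd := (h.of_equivalent (i' := .inl ()) (j' := .inl ()) (mul_left hunit _)
    (by simp [Matrix.transvection_mul_apply_same])).dvd_row (.inr j)
  simpa [Matrix.transvection_mul_apply_same] using hadd

theorem exists_equivalent_fromBlocks_smul {M : Matrix (Unit ⊕ κ) (Unit ⊕ κ) R} (hM : M ≠ 0) :
    ∃ (a : R) (D : Matrix κ κ R),
      UnimodularEquivalent M (.fromBlocks (.diagonal fun _ => a) 0 0 (a • D)) := by
  obtain ⟨N, hMN, hN⟩ := exists_isMinimalEntry hM (.inl ())
  obtain ⟨D, hD⟩ := hN.exists_equivalent_fromBlocks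
  choose D' hD' using (hN.of_equivalent hD rfl).dvd_of_fromBlocks
  refine ⟨N.toBlocks₁₁ () (), Matrix.of D', ?_⟩
  convert hMN.trans hD
  · ext i j
    simp
  · ext i j
    simp [hD']

theorem exists_equivalent_diagonal (n : ℕ) (M : Matrix (Fin n) (Fin n) R) :
    ∃ d : Fin n → R, (∀ i j, i ≤ j → d i ∣ d j) ∧ UnimodularEquivalent M (.diagonal d) := by
  induction n with
  | zero => exact ⟨0, fun i => i.elim0, by convert refl M; exact Subsingleton.elim _ _⟩
  | succ n ih =>
    rcases eq_or_ne M 0 with rfl | hM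
    · exact ⟨0, fun _ _ _ => dvd_rfl, by simpa using refl 0⟩
    let e : Fin (n + 1) ≃ Unit ⊕ Fin n :=
      (finSuccEquiv n).trans ((Equiv.optionEquivSumPUnit _).trans (Equiv.sumComm _ _))
    have he₀ : e 0 = .inl () := rfl
    have hsucc (i : Fin n) : e i.succ = .inr i := by simp [e]
    obtain ⟨a, D, hD⟩ := exists_equivalent_fromBlocks_smul (M := M.submatrix e.symm e.symm)
      ((Matrix.reindexLinearEquiv R R e e).map_ne_zero_iff.2 hM)
    obtain ⟨d, hd, hDd⟩ := ih D
    refine ⟨Sum.elim (fun _ => a) (a • d) ∘ e, fun i j hij => ?_, ?_⟩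
    · cases i using Fin.cases with
      | zero => cases j using Fin.cases <;> simp [he₀, hsucc]
      | succ i =>
        cases j using Fin.cases with
        | zero => simp at hij
        | succ j => simpa [hsucc] using mul_dvd_mul_left a (hd i j (by simpa using hij))
    · have h := (hD.trans (hDd.smul a).fromBlocks).submatrix e
      rwa [← Matrix.diagonal_smul, Matrix.fromBlocks_diagonal, Matrix.submatrix_diagonal_equiv,
        Matrix.submatrix_submatrix, Equiv.symm_comp_self, Matrix.submatrix_id_id] at h

end EuclideanDomain

end UnimodularEquivalent

open UnimodularEquivalent in
theorem exists_hasSmithNormalForm {ι : Type*} [Fintype ι] [DecidableEq ι] (M : Matrix ι ι ℤ) :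
    ∃ D, HasSmithNormalForm M D := by
  let e := Fintype.equivFin ι
  obtain ⟨d, hd, h⟩ := exists_equivalent_diagonal _ (M.submatrix e.symm e.symm)
  obtain ⟨P, Q, hP, hQ, hPQ⟩ := h.submatrix e
  choose u hu using fun i => Int.associated_natAbs (d i)
  have hunit : IsUnit (Matrix.diagonal fun i => (u (e i) : ℤ)) :=
    Matrix.isUnit_diagonal.2 (Pi.isUnit_iff.2 fun i => (u (e i)).isUnit)
  refine ⟨_, e, fun i => (d i).natAbs, P, Q * Matrix.diagonal fun i => (u (e i) : ℤ),
    fun i j hij => Int.natAbs_dvd_natAbs.2 (hd i j hij), (Matrix.isUnit_iff_isUnit_det P).1 hP,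
    (Matrix.isUnit_iff_isUnit_det _).1 (hQ.mul hunit), ?_, rfl⟩
  rw [Matrix.submatrix_submatrix, Equiv.symm_comp_self, Matrix.submatrix_id_id,
    Matrix.submatrix_diagonal_equiv] at hPQ
  rw [← Matrix.mul_assoc, hPQ, Matrix.diagonal_mul_diagonal]
  simp only [Function.comp_apply, hu]

section RowModule

variable {ι R : Type*} [Fintype ι] [DecidableEq ι] [CommRing R]

theorem UnimodularEquivalent.card_range_vecMulLinear {M N : Matrix ι ι R}
    (h : UnimodularEquivalent M N) :
    Nat.card (LinearMap.range M.vecMulLinear) = Nat.card (LinearMap.range N.vecMulLinear) := by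
  obtain ⟨P, Q, hP, hQ, rfl⟩ := h
  have hmul (A B : Matrix ι ι R) :
      (A * B).vecMulLinear = B.vecMulLinear ∘ₗ A.vecMulLinear :=
    LinearMap.ext fun x => (Matrix.vecMul_vecMul x A B).symm
  have hsurj : LinearMap.range P.vecMulLinear = ⊤ :=
    LinearMap.range_eq_top.2 (Matrix.vecMul_surjective_iff_isUnit.2 hP)
  rw [hmul, LinearMap.range_comp, hmul, LinearMap.range_comp, hsurj, Submodule.map_top]
  exact Nat.card_congr
    (Submodule.equivMapOfInjective _ (Matrix.vecMul_injective_of_isUnit hQ) _).toEquiv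

theorem card_range_vecMulLinear_diagonal (d : ι → R) :
    Nat.card (LinearMap.range (Matrix.diagonal d).vecMulLinear) =
      ∏ i, Nat.card (Ideal.span {d i}) := by
  have hmem (x : ι → R) : x ∈ LinearMap.range (Matrix.diagonal d).vecMulLinear ↔
      ∀ i, x i ∈ Ideal.span {d i} := by
    simp only [LinearMap.mem_range, Matrix.vecMulLinear_apply, Ideal.mem_span_singleton',
      funext_iff, Matrix.vecMul_diagonal, Classical.skolem]
  rw [← Nat.card_pi]
  exact Nat.card_congr ((Equiv.subtypeEquivRight hmem).trans Equiv.subtypePiEquivPi)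

end RowModule

theorem HasSmithNormalForm.card_range_vecMulLinear {ι R : Type*} [Fintype ι] [DecidableEq ι]
    [CommRing R] {M : Matrix ι ι ℤ} {D : Multiset ℕ} (h : HasSmithNormalForm M D) :
    Nat.card (LinearMap.range (M.map (Int.castRingHom R)).vecMulLinear) =
      (D.map fun d : ℕ => Nat.card (Ideal.span {(d : R)})).prod := by
  obtain ⟨e, d, P, Q, -, hP, hQ, hPQ, rfl⟩ := h
  have hM : UnimodularEquivalent M (Matrix.diagonal fun i => (d (e i) : ℤ)) :=
    ⟨P, Q, (Matrix.isUnit_iff_isUnit_det P).2 hP, (Matrix.isUnit_iff_isUnit_det Q).2 hQ, hPQ⟩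
  have hcast : (Matrix.diagonal fun i => (d (e i) : ℤ)).map (Int.castRingHom R) =
      Matrix.diagonal fun i => (d (e i) : R) := by
    simp [Matrix.diagonal_map]
  rw [(hM.map _).card_range_vecMulLinear, hcast, card_range_vecMulLinear_diagonal,
    e.prod_comp fun j => Nat.card (Ideal.span {(d j : R)}), Multiset.map_map]
  rfl

theorem UnimodularEquivalent.hasSmithNormalForm {ι : Type*} [Fintype ι] [DecidableEq ι]
    {M N : Matrix ι ι ℤ} (h : UnimodularEquivalent M N) {D : Multiset ℕ}
    (hM : HasSmithNormalForm M D) : HasSmithNormalForm N D := by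
  obtain ⟨e, d, P, Q, hd, hP, hQ, hPQ, rfl⟩ := hM
  rw [← Matrix.isUnit_iff_isUnit_det] at hP hQ
  obtain ⟨P', Q', hP', hQ', hPQ'⟩ := h.symm.trans ⟨P, Q, hP, hQ, hPQ⟩
  exact ⟨e, d, P', Q', hd, (Matrix.isUnit_iff_isUnit_det _).1 hP',
    (Matrix.isUnit_iff_isUnit_det _).1 hQ', hPQ', rfl⟩

theorem hasSmithNormalForm_snf {n : ℕ} (f : BoolFn n) :
    HasSmithNormalForm (devMatrix (graphFn f)) (snf f) :=
  Classical.epsilon_spec (exists_hasSmithNormalForm _)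

theorem devMatrix_graphFn_apply {n : ℕ} (f : BoolFn n) (g p : (Fin n → ZMod 2) × ZMod 2) :
    devMatrix (graphFn f) g p = if f (p.1 + g.1) = p.2 + g.2 then 1 else 0 := by
  classical
  have hmem : p ∈ (fun a => a + g) '' graphFn f ↔ f (p.1 + g.1) = p.2 + g.2 := by
    simp [graphFn, Prod.ext_iff, ZModModule.neg_eq_self]
  rw [devMatrix, Matrix.of_apply, Set.indicator_apply]
  simp only [hmem, Pi.one_apply]

theorem EquivalentFn.unimodularEquivalent_devMatrix {n : ℕ} {f f' : BoolFn n}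
    (h : EquivalentFn f f') :
    UnimodularEquivalent (devMatrix (graphFn f)) (devMatrix (graphFn f')) := by
  obtain ⟨A, l, ⟨a, b, hl⟩, hf⟩ := h
  let φ : (Fin n → ZMod 2) × ZMod 2 ≃ (Fin n → ZMod 2) × ZMod 2 :=
    A.linear.toEquiv.prodShear fun x => Equiv.addRight (a ⬝ᵥ x)
  let ψ : (Fin n → ZMod 2) × ZMod 2 ≃ (Fin n → ZMod 2) × ZMod 2 :=
    A.toEquiv.prodShear fun x => Equiv.addRight (l x)
  convert UnimodularEquivalent.submatrix_submatrix (devMatrix (graphFn f)) φ ψ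
  ext ⟨x, y⟩ ⟨u, v⟩
  have hA : A (u + x) = A u + A.linear x := by
    rw [add_comm u, add_comm (A u)]
    exact A.map_vadd u x
  have hlin : l (u + x) = l u + a ⬝ᵥ x := by
    rw [hl, hl, dotProduct_add, add_right_comm]
  have hiff : f (A u + A.linear x) + (l u + a ⬝ᵥ x) = v + y ↔
      f (A u + A.linear x) = v + l u + (y + a ⬝ᵥ x) := by
    rw [← eq_sub_iff_add_eq, CharTwo.sub_eq_add, add_add_add_comm]
  simp [devMatrix_graphFn_apply, φ, ψ, Equiv.prodShear, hf, hA, hlin, hiff]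

theorem EquivalentFn.snf_eq {n : ℕ} {f f' : BoolFn n} (h : EquivalentFn f f') :
    snf f = snf f' := by
  have hU := h.unimodularEquivalent_devMatrix
  exact congrArg Classical.epsilon (funext fun D => propext
    ⟨hU.hasSmithNormalForm, hU.symm.hasSmithNormalForm⟩)

/-- The indicator function of the graph of `f`, as a Boolean function in `n + 1` variables. -/
def graphIndicator {n : ℕ} (f : BoolFn n) : BoolFn (n + 1) :=
  fun z => f (Fin.init z) + z (Fin.last n) + 1

/-- The translate `x ↦ g (x + a)` of a Boolean function, with the values `0` and `1` taken
modulo `q`. -/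
def translateVec (q : ℕ) {n : ℕ} (g : BoolFn n) (a x : Fin n → ZMod 2) : ZMod q :=
  (g (x + a)).val

/-- The `ZMod q`-module spanned by the translates of `g`. For the indicator function of the graph
of `f` it is the row module, modulo `q`, of the incidence matrix defining `snf f`. -/
def translateModule (q : ℕ) {n : ℕ} (g : BoolFn n) :
    Submodule (ZMod q) ((Fin n → ZMod 2) → ZMod q) :=
  Submodule.span (ZMod q) (Set.range (translateVec q g))

theorem map_range_vecMulLinear_devMatrix (q : ℕ) {n : ℕ} (f : BoolFn n) :
    (LinearMap.range ((devMatrix (graphFn f)).map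
      (Int.castRingHom (ZMod q))).vecMulLinear).map
        (LinearMap.funLeft (ZMod q) (ZMod q) fun z : Fin (n + 1) → ZMod 2 =>
          (Fin.init z, z (Fin.last n))) = translateModule q (graphIndicator f) := by
  have hval (s t : ZMod 2) : ((s + t + 1).val : ZMod q) = if s = t then 1 else 0 := by
    have h : (s + t + 1).val = if s = t then 1 else 0 := by
      revert s t
      decide
    rw [h]
    split_ifs <;> simp
  have hsurj : Function.Surjective fun z : Fin (n + 1) → ZMod 2 =>
      (Fin.init z, z (Fin.last n)) := fun p => ⟨Fin.snoc p.1 p.2, by simp⟩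
  rw [range_vecMulLinear, Submodule.map_span, ← Set.range_comp, ← hsurj.range_comp]
  congr 2
  ext a z
  change ((devMatrix (graphFn f) (Fin.init a, a (Fin.last n)) (Fin.init z, z (Fin.last n)) : ℤ) :
    ZMod q) = ((f (Fin.init z + Fin.init a) + (z + a) (Fin.last n) + 1).val : ZMod q)
  rw [devMatrix_graphFn_apply, hval]
  simp [Int.cast_ite]

theorem card_translateModule_eq_prod_snf (q : ℕ) {n : ℕ} (f : BoolFn n) :
    Nat.card (translateModule q (graphIndicator f)) =
      ((snf f).map fun d : ℕ => Nat.card (Ideal.span {(d : ZMod q)})).prod := by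
  have hsurj : Function.Surjective fun z : Fin (n + 1) → ZMod 2 =>
      (Fin.init z, z (Fin.last n)) := fun p => ⟨Fin.snoc p.1 p.2, by simp⟩
  rw [← (hasSmithNormalForm_snf f).card_range_vecMulLinear, ← map_range_vecMulLinear_devMatrix]
  exact (Nat.card_congr (Submodule.equivMapOfInjective _
    (LinearMap.funLeft_injective_of_surjective _ _ _ hsurj) _).toEquiv).symm

section ModularTables

variable {k n : ℕ}

theorem table_add_smul (hk : 0 < k) {c : ℕ} (hc : c < 2 ^ k)
    (u e : (Fin n → ZMod 2) → ZMod (2 ^ k)) :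
    (table (2 * k) u + c * table (2 * k) e) &&& repunit (2 * k) (2 ^ n) * (2 ^ k - 1) =
      table (2 * k) (u + (c : ZMod (2 ^ k)) • e) := by
  have hsq : 2 ^ (2 * k) = 2 ^ k * 2 ^ k := by rw [two_mul, pow_add]
  have hlt (j : ℕ) : (u (point n j)).val + c * (e (point n j)).val < 2 ^ (2 * k) := by
    have hu := ZMod.val_lt (u (point n j))
    have he := Nat.mul_le_mul_left c (ZMod.val_lt (e (point n j))).le
    have hc' := Nat.mul_le_mul_right (2 ^ k) (Nat.succ_le_of_lt hc)
    rw [Nat.succ_mul] at hc'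
    omega
  have hmask : 2 ^ k - 1 < 2 ^ (2 * k) :=
    (Nat.sub_lt (Nat.two_pow_pos k) one_pos).trans_le (Nat.pow_le_pow_right two_pos (by omega))
  rw [table, table, mul_pack, pack_add, pack_and_repunit_mul hlt (by omega) hmask]
  refine pack_congr fun j _ => ?_
  rw [Nat.and_two_pow_sub_one_eq_mod, ← ZMod.val_natCast]
  simp

theorem table_and_repunit_mul_eq_zero_iff (hk : 0 < k) {l : ℕ} (hl : l ≤ k)
    (e : (Fin n → ZMod 2) → ZMod (2 ^ k)) :
    table (2 * k) e &&& repunit (2 * k) (2 ^ n) * (2 ^ l - 1) = 0 ↔ ∀ x, 2 ^ l ∣ (e x).val := by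
  have hle : 2 ^ k ≤ 2 ^ (2 * k) := Nat.pow_le_pow_right two_pos (by omega)
  have hmask : 2 ^ l - 1 < 2 ^ (2 * k) :=
    (Nat.sub_lt (Nat.two_pow_pos l) one_pos).trans_le
      ((Nat.pow_le_pow_right two_pos hl).trans hle)
  rw [table, pack_and_repunit_mul (fun j => val_lt_two_pow hle _) (by omega) hmask, pack]
  simp only [Finset.sum_eq_zero_iff, Finset.mem_range, mul_eq_zero, (Nat.two_pow_pos _).ne',
    or_false, Nat.and_two_pow_sub_one_eq_mod, ← Nat.dvd_iff_mod_eq_zero]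
  exact ⟨fun h x => point_code x ▸ h _ (code_lt x), fun h j _ => h _⟩

end ModularTables

section TailModules

variable (k : ℕ) {n : ℕ} (g : BoolFn n)

/-- The module generated by the translates of `g` by the points with codes at least `S` and by the
doubles of all translates. -/
def tailModule (S : ℕ) : Submodule (ZMod (2 ^ k)) ((Fin n → ZMod 2) → ZMod (2 ^ k)) :=
  Submodule.span (ZMod (2 ^ k)) (translateVec (2 ^ k) g '' {a | S ≤ code a}) ⊔
    Ideal.span {(2 : ZMod (2 ^ k))} • translateModule (2 ^ k) g

theorem tailModule_le_iff {S : ℕ}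
    {N : Submodule (ZMod (2 ^ k)) ((Fin n → ZMod 2) → ZMod (2 ^ k))} :
    tailModule k g S ≤ N ↔ (∀ a, S ≤ code a → translateVec (2 ^ k) g a ∈ N) ∧
      Ideal.span {(2 : ZMod (2 ^ k))} • translateModule (2 ^ k) g ≤ N := by
  rw [tailModule, sup_le_iff, Submodule.span_le, Set.image_subset_iff]
  rfl

variable {k g}

theorem translateVec_mem_tailModule {S : ℕ} {a : Fin n → ZMod 2} (h : S ≤ code a) :
    translateVec (2 ^ k) g a ∈ tailModule k g S :=
  ((tailModule_le_iff k g).1 le_rfl).1 a h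

theorem span_two_smul_le_tailModule (S : ℕ) :
    Ideal.span {(2 : ZMod (2 ^ k))} • translateModule (2 ^ k) g ≤ tailModule k g S := le_sup_right

theorem tailModule_antitone : Antitone (tailModule k g) := fun _ _ h =>
  (tailModule_le_iff k g).2 ⟨fun _ ha => translateVec_mem_tailModule (h.trans ha),
    span_two_smul_le_tailModule _⟩

theorem tailModule_le_translateModule (S : ℕ) : tailModule k g S ≤ translateModule (2 ^ k) g :=
  (tailModule_le_iff k g).2 ⟨fun a _ => Submodule.subset_span (Set.mem_range_self a),
    Submodule.smul_le_right⟩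

theorem two_mul_smul_mem_tailModule {e : (Fin n → ZMod 2) → ZMod (2 ^ k)}
    (he : e ∈ translateModule (2 ^ k) g) (c : ZMod (2 ^ k)) (S : ℕ) :
    (2 * c) • e ∈ tailModule k g S :=
  span_two_smul_le_tailModule S <|
    Submodule.smul_mem_smul (Ideal.mul_mem_right _ _ (Ideal.mem_span_singleton_self 2)) he

theorem code_add (a b : Fin n → ZMod 2) : code (a + b) = code a ^^^ code b := by
  rw [← code_point (Nat.xor_lt_two_pow (code_lt a) (code_lt b)), point_xor, point_code, point_code]

theorem map_funLeft_tailModule_le {S S' : ℕ} {b : Fin n → ZMod 2} (h : S' + code b ≤ S) :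
    (tailModule k g S).map (LinearMap.funLeft _ _ (· + b)) ≤ tailModule k g S' := by
  have htranslate (a : Fin n → ZMod 2) :
      LinearMap.funLeft (ZMod (2 ^ k)) (ZMod (2 ^ k)) (· + b) (translateVec (2 ^ k) g a) =
        translateVec (2 ^ k) g (a + b) := by
    ext x
    simp only [translateVec, LinearMap.funLeft_apply, add_assoc, add_comm b]
  have hmap : (translateModule (2 ^ k) g).map (LinearMap.funLeft _ _ (· + b)) ≤
      translateModule (2 ^ k) g := by
    rw [translateModule, Submodule.map_span, Submodule.span_le]
    rintro _ ⟨_, ⟨a, rfl⟩, rfl⟩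
    exact htranslate a ▸ Submodule.subset_span (Set.mem_range_self _)
  rw [Submodule.map_le_iff_le_comap, tailModule_le_iff, ← Submodule.map_le_iff_le_comap,
    Submodule.map_smul'']
  refine ⟨fun a ha => ?_,
    (Submodule.smul_mono le_rfl hmap).trans (span_two_smul_le_tailModule S')⟩
  have hxor := xor_le_add (code a ^^^ code b) (code b)
  rw [Nat.xor_assoc, Nat.xor_self, Nat.xor_zero] at hxor
  rw [Submodule.mem_comap, htranslate]
  exact translateVec_mem_tailModule (by rw [code_add]; omega)

-- Translating the relation by `C ^^^ S` lowers the codes that occur in it by at most `C - S`.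
theorem translateVec_mem_tailModule_of_and_eq {C S : ℕ} (hC : C < 2 ^ n) (hS : S &&& C = S)
    (h : translateVec (2 ^ k) g (point n C) ∈ tailModule k g (C + 1)) :
    translateVec (2 ^ k) g (point n S) ∈ tailModule k g (S + 1) := by
  have hSC : S ≤ C := hS ▸ Nat.and_le_right
  have hsum := xor_add_two_mul_and S C
  rw [hS] at hsum
  have hlt : S ^^^ C < 2 ^ n := Nat.xor_lt_two_pow (hSC.trans_lt hC) hC
  have hcode : S + 1 + code (point n (S ^^^ C)) ≤ C + 1 := by
    rw [code_point hlt]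
    omega
  convert map_funLeft_tailModule_le hcode (Submodule.mem_map_of_mem h) using 1
  ext x
  rw [LinearMap.funLeft_apply, translateVec, translateVec, point_xor, add_assoc x,
    add_assoc, ZModModule.add_self, add_zero]

theorem translateModule_le_of_forall_mem_tailModule
    {N : Submodule (ZMod (2 ^ k)) ((Fin n → ZMod 2) → ZMod (2 ^ k))}
    (h : ∀ S < 2 ^ n, translateVec (2 ^ k) g (point n S) ∈ N ∨
      translateVec (2 ^ k) g (point n S) ∈ tailModule k g (S + 1)) :
    translateModule (2 ^ k) g ≤ N := by
  have hjac : Ideal.span {(2 : ZMod (2 ^ k))} ≤ Ideal.jacobson ⊥ := by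
    rw [Ideal.jacobson_bot]
    refine le_trans ?_ (nilradical_le_jacobson _)
    rw [Ideal.span_singleton_le_iff_mem, mem_nilradical]
    exact ⟨k, by exact_mod_cast ZMod.natCast_self (2 ^ k)⟩
  refine Submodule.le_of_le_smul_of_le_jacobson_bot (Submodule.fg_span (Set.finite_range _)) hjac ?_
  have htail (S : ℕ) (hS : S ≤ 2 ^ n) :
      tailModule k g S ≤ N ⊔ Ideal.span {(2 : ZMod (2 ^ k))} • translateModule (2 ^ k) g := by
    induction hS using Nat.decreasingInduction with
    | self =>
      exact (tailModule_le_iff k g).2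
        ⟨fun a ha => absurd (code_lt a) ha.not_gt, le_sup_right⟩
    | of_succ S hS ih =>
      refine (tailModule_le_iff k g).2 ⟨fun a ha => ?_, le_sup_right⟩
      rcases ha.eq_or_lt with rfl | ha
      · rw [← point_code a]
        exact (h _ hS).elim (fun ha => le_sup_left (a := N) ha) fun ha => ih ha
      · exact ih (translateVec_mem_tailModule ha)
  refine Submodule.span_le.2 ?_
  rintro _ ⟨a, rfl⟩
  exact htail 0 (Nat.zero_le _) (translateVec_mem_tailModule (Nat.zero_le _))

end TailModules

section EchelonSystems

/-- A row of an echelon system over `ZMod (2 ^ k)`. The vector with table `vec` is divisible by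
`2 ^ level`, its coordinate at the point with code `pivot` is `2 ^ level * u` for an odd `u`, and
`negUnit` is `-u` modulo `2 ^ k`, which is also `-u⁻¹` for `k ≤ 3`. Here `pivot` and `level` are the
quotient and the remainder of `bit` by the digit width `2 * k`. The row arose from the translate by
the point with code `tag`. -/
structure EchelonRow where
  vec : ℕ
  bit : ℕ
  tag : ℕ
  negUnit : ℕ

/-- Adds to the vector with table `v` the multiple of the row that clears the pivot, rounded to an
even multiple when the row does not arise from a code greater than `C`. The number `q` is the
modulus, and `mask` has the digits `q - 1`. Bare recursors and functions of `Nat` instead of pattern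
matching and notation spare the kernel most of the unfolding in this innermost loop. -/
noncomputable def EchelonRow.reduce (q mask C : ℕ) (r : EchelonRow) (v : ℕ) : ℕ :=
  Nat.rec v
    (fun c _ => bif r.tag.ble C then (v.add ((c.succ.sub (c.succ.mod 2)).mul r.vec)).land mask
      else (v.add (c.succ.mul r.vec)).land mask)
    (((v.shiftRight r.bit).mul r.negUnit).mod q)

/-- The reduction of the vector with table `v` by the rows in `E`. -/
noncomputable def reduceRows (q mask C : ℕ) (E : List EchelonRow) (v : ℕ) : ℕ :=
  List.rec v (fun r _ u => force u (r.reduce q mask C)) E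

/-- The number whose binary digits indicate the `j < 2 ^ i` with `j &&& C = j`. -/
def submaskBits (C : ℕ) : ℕ → ℕ
  | 0 => 1
  | i + 1 => force (submaskBits C i) fun s => bif C.testBit i then s ||| s <<< 2 ^ i else s

/-- The number whose binary digits indicate the codes from which the rows in `E` arise. -/
def tagBits : List EchelonRow → ℕ
  | [] => 0
  | r :: E => tagBits E ||| 2 ^ r.tag

/-- The greatest binary digit position below `2 ^ i` that is set in `v`. -/
def topBit : ℕ → ℕ → ℕ
  | 0, _ => 0
  | i + 1, v => force (v >>> 2 ^ i) fun u =>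
    match u with
    | 0 => topBit i v
    | _ + 1 => 2 ^ i + topBit i u

/-- Extends the echelon system `E` by rows of level `l`, obtained from the translates of the
function with table `T` by the points with codes below `C`, in decreasing order. The codes indicated
by `done` are skipped. The number `one` has the digits `1`. -/
noncomputable def addRows (k n l one T : ℕ) : ℕ → ℕ → List EchelonRow → List EchelonRow
  | 0, _, E => E
  | C + 1, done, E =>
    bif done.testBit C then addRows k n l one T C done E else
    force (2 ^ k) fun q => force (one * (q - 1)) fun mask =>
    force (translateTable (2 * k) n C n T) fun v => force (reduceRows q mask C E v) fun v =>
    match v &&& one * (2 ^ (l + 1) - 1) with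
    | 0 => force (done ||| submaskBits C n) fun done => addRows k n l one T C done E
    | _ + 1 =>
      force (topBit (k + n) (v &&& one * 2 ^ l)) fun bit =>
      force (q - (v >>> bit) % q) fun negUnit =>
      addRows k n l one T C done (⟨v, bit, C, negUnit⟩ :: E)

/-- The value `f E`. The case distinction makes the kernel evaluate `E` to a constructor. -/
def forceRows {α : Type} (E : List EchelonRow) (f : List EchelonRow → α) : α :=
  match E with
  | [] => f []
  | r :: E => f (r :: E)

/-- The rows of all levels below `l` for the function with table `T`. -/
noncomputable def echelonRows (k n one T : ℕ) : ℕ → List EchelonRow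
  | 0 => []
  | l + 1 => forceRows (echelonRows k n one T l) fun E =>
    force (tagBits E) fun done => addRows k n l one T (2 ^ n) done E

/-- The rows are divisible by the powers of two given by their levels, the quotients are odd at the
pivots, and the pivots of later rows are zeros of earlier ones and of `U`. -/
def isEchelon (k n one : ℕ) : ℕ → List EchelonRow → Bool
  | _, [] => true
  | U, r :: E =>
    force U fun U => force (r.bit / (2 * k)) fun pivot => force (r.bit % (2 * k)) fun level =>
    pivot.blt (2 ^ n) && (r.vec &&& one * (2 ^ level - 1)).beq 0 &&
    (digit (2 * k) r.vec pivot % 2 ^ (level + 1)).beq (2 ^ level) &&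
    (digit (2 * k) U pivot).beq 0 && isEchelon k n one (U ||| r.vec) E

/-- The base-two logarithm of the number of elements of the module spanned by an echelon system. -/
def echelonWeight (k : ℕ) : List EchelonRow → ℕ
  | [] => 0
  | r :: E => echelonWeight k E + (k - r.bit % (2 * k))

/-- Elimination verifies that the translates of the function with table `T` span a module with
`2 ^ W` elements. -/
noncomputable def translateModuleCheck (k n W T : ℕ) : Bool :=
  force T fun T => force (repunit (2 * k) (2 ^ n)) fun one =>
  forceRows (echelonRows k n one T k) fun E =>
  isEchelon k n one 0 E && (echelonWeight k E).beq W

end EchelonSystems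

section Cardinality

theorem card_sup_of_disjoint {R M : Type*} [Ring R] [AddCommGroup M] [Module R M]
    {p q : Submodule R M} (h : Disjoint p q) :
    Nat.card ↥(p ⊔ q) = Nat.card p * Nat.card q := by
  have hker : LinearMap.ker (p.subtype.coprod q.subtype) = ⊥ := by
    rw [LinearMap.ker_coprod_of_disjoint_range _ _ (by simpa using h)]
    simp
  have hrange : LinearMap.range (p.subtype.coprod q.subtype) = p ⊔ q := by
    simp [LinearMap.range_coprod]
  rw [← Nat.card_prod, ← hrange]
  exact (Nat.card_congr (LinearEquiv.ofInjective _ (LinearMap.ker_eq_bot.1 hker)).toEquiv).symm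

theorem card_span_singleton_zmod {m : ℕ} {M : Type*} [AddCommGroup M] [Module (ZMod m) M] (e : M) :
    Nat.card (Submodule.span (ZMod m) {e}) = addOrderOf e := by
  have : Submodule.span (ZMod m) {e} =
      AddSubgroup.toZModSubmodule m (AddSubgroup.zmultiples e) := by
    refine le_antisymm ?_ fun x hx => ?_
    · rw [Submodule.span_singleton_le_iff_mem]
      exact AddSubgroup.mem_zmultiples e
    · obtain ⟨c, rfl⟩ := AddSubgroup.mem_zmultiples_iff.1 hx
      exact zsmul_mem (Submodule.mem_span_singleton_self e) c
  rw [this]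
  exact Nat.card_zmultiples e

theorem natCast_mul_eq_zero_iff_of_dvd {k l c : ℕ} (hl : l ≤ k) {s : ZMod (2 ^ k)}
    (hs : s.val % 2 ^ (l + 1) = 2 ^ l) : (c : ZMod (2 ^ k)) * s = 0 ↔ 2 ^ (k - l) ∣ c := by
  obtain ⟨m, hm⟩ : ∃ m, s.val = 2 ^ l * (2 * m + 1) :=
    ⟨s.val / 2 ^ (l + 1), (Nat.div_add_mod s.val (2 ^ (l + 1))).symm.trans (by rw [hs]; ring)⟩
  have hcast : (c : ZMod (2 ^ k)) * s = ((2 ^ l * (c * (2 * m + 1)) : ℕ) : ZMod (2 ^ k)) := by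
    rw [mul_left_comm, ← hm, Nat.cast_mul, ZMod.natCast_zmod_val]
  have hcop : (2 ^ (k - l)).Coprime (2 * m + 1) := by
    refine Nat.Coprime.pow_left _ ?_
    simp
  rw [hcast, ZMod.natCast_eq_zero_iff, ← Nat.add_sub_cancel' hl, pow_add,
    Nat.mul_dvd_mul_iff_left (Nat.two_pow_pos l), hcop.dvd_mul_right, Nat.add_sub_cancel_left]

theorem natCast_smul_eq_zero_of_dvd {k l c : ℕ} (hl : l ≤ k) {X : Type*} {e : X → ZMod (2 ^ k)}
    (he : ∀ x, 2 ^ l ∣ (e x).val) (hc : 2 ^ (k - l) ∣ c) : (c : ZMod (2 ^ k)) • e = 0 := by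
  ext x
  have hdvd := mul_dvd_mul hc (he x)
  rw [← pow_add, Nat.sub_add_cancel hl, ← ZMod.natCast_eq_zero_iff, Nat.cast_mul,
    ZMod.natCast_zmod_val] at hdvd
  exact hdvd

theorem card_span_singleton_sup {k l : ℕ} (hl : l ≤ k) {X : Type*} {e : X → ZMod (2 ^ k)}
    (he : ∀ x, 2 ^ l ∣ (e x).val) {x : X} (hx : (e x).val % 2 ^ (l + 1) = 2 ^ l)
    {N : Submodule (ZMod (2 ^ k)) (X → ZMod (2 ^ k))} (hN : ∀ y ∈ N, y x = 0) :
    Nat.card ↥(Submodule.span (ZMod (2 ^ k)) {e} ⊔ N) = 2 ^ (k - l) * Nat.card N := by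
  have heval (c : ℕ) (h : (c : ZMod (2 ^ k)) * e x = 0) : (c : ZMod (2 ^ k)) • e = 0 :=
    natCast_smul_eq_zero_of_dvd hl he ((natCast_mul_eq_zero_iff_of_dvd hl hx).1 h)
  have hdisj : Disjoint (Submodule.span (ZMod (2 ^ k)) {e}) N := by
    rw [Submodule.disjoint_def]
    intro y hy hyN
    obtain ⟨c, rfl⟩ := Submodule.mem_span_singleton.1 hy
    rw [← ZMod.natCast_zmod_val c] at hyN ⊢
    exact heval _ (hN _ hyN)
  have horder : addOrderOf e = 2 ^ (k - l) := by
    refine Nat.dvd_antisymm (addOrderOf_dvd_of_nsmul_eq_zero ?_) ?_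
    · rw [← Nat.cast_smul_eq_nsmul (ZMod (2 ^ k))]
      exact natCast_smul_eq_zero_of_dvd hl he dvd_rfl
    · have h := congrFun (addOrderOf_nsmul_eq_zero e) x
      rwa [← Nat.cast_smul_eq_nsmul (ZMod (2 ^ k)), Pi.smul_apply, smul_eq_mul, Pi.zero_apply,
        natCast_mul_eq_zero_iff_of_dvd hl hx] at h
  rw [card_sup_of_disjoint hdisj, card_span_singleton_zmod, horder]

end Cardinality

section RowSpan

variable {k n : ℕ}

/-- The module spanned by the vectors of the rows in `E`. -/
def rowSpan (k n : ℕ) (E : List EchelonRow) :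
    Submodule (ZMod (2 ^ k)) ((Fin n → ZMod 2) → ZMod (2 ^ k)) :=
  Submodule.span (ZMod (2 ^ k)) {e | ∃ r ∈ E, r.vec = table (2 * k) e}

theorem rowSpan_mono {E E' : List EchelonRow} (h : E ⊆ E') : rowSpan k n E ≤ rowSpan k n E' :=
  Submodule.span_mono fun _ ⟨r, hr, he⟩ => ⟨r, h hr, he⟩

theorem mem_rowSpan {E : List EchelonRow} {r : EchelonRow} (hr : r ∈ E)
    {e : (Fin n → ZMod 2) → ZMod (2 ^ k)} (he : r.vec = table (2 * k) e) : e ∈ rowSpan k n E :=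
  Submodule.subset_span ⟨r, hr, he⟩

theorem two_pow_le_two_pow_two_mul (k : ℕ) : 2 ^ k ≤ 2 ^ (2 * k) :=
  Nat.pow_le_pow_right two_pos (by omega)

theorem rowSpan_cons {r : EchelonRow} {e : (Fin n → ZMod 2) → ZMod (2 ^ k)}
    (he : r.vec = table (2 * k) e) (E : List EchelonRow) :
    rowSpan k n (r :: E) = Submodule.span (ZMod (2 ^ k)) {e} ⊔ rowSpan k n E := by
  have hinj {e'} : r.vec = table (2 * k) e' ↔ e' = e := by
    rw [he, (table_injective (two_pow_le_two_pow_two_mul k)).eq_iff, eq_comm]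
  rw [rowSpan, rowSpan, ← Submodule.span_union]
  congr 1
  ext e'
  simp [hinj]

theorem digit_or_eq_zero_iff {w v v' j : ℕ} :
    digit w (v ||| v') j = 0 ↔ digit w v j = 0 ∧ digit w v' j = 0 := by
  rw [digit, Nat.shiftRight_or_distrib, Nat.and_or_distrib_right, Nat.or_eq_zero_iff]
  rfl

theorem card_sup_rowSpan_of_isEchelon (hk : 0 < k) {E : List EchelonRow}
    (hE : ∀ r ∈ E, ∃ e : (Fin n → ZMod 2) → ZMod (2 ^ k), r.vec = table (2 * k) e) {U : ℕ}
    {N : Submodule (ZMod (2 ^ k)) ((Fin n → ZMod 2) → ZMod (2 ^ k))}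
    (hN : ∀ x, digit (2 * k) U (code x) = 0 → ∀ y ∈ N, y x = 0)
    (h : isEchelon k n (repunit (2 * k) (2 ^ n)) U E = true) :
    Nat.card ↥(N ⊔ rowSpan k n E) = 2 ^ echelonWeight k E * Nat.card N := by
  induction E generalizing U N with
  | nil => simp [rowSpan, echelonWeight]
  | cons r E ih =>
    rw [List.forall_mem_cons] at hE
    obtain ⟨⟨e, he⟩, hE⟩ := hE
    have hdigit (x : Fin n → ZMod 2) : digit (2 * k) r.vec (code x) = (e x).val := by
      rw [he, digit_table (two_pow_le_two_pow_two_mul k)]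
    simp only [isEchelon, force_eq, Bool.and_eq_true, Nat.blt_eq, Nat.beq_eq] at h
    obtain ⟨⟨⟨⟨hpivot, hdvd⟩, hunit⟩, hzero⟩, hech⟩ := h
    rw [← code_point hpivot] at hunit hzero
    rw [hdigit] at hunit
    have hlevel : r.bit % (2 * k) < k := by
      rw [← Nat.pow_lt_pow_iff_right one_lt_two, ← hunit]
      exact (Nat.mod_le _ _).trans_lt (ZMod.val_lt _)
    rw [he, table_and_repunit_mul_eq_zero_iff hk hlevel.le] at hdvd
    have hspan (x) (hx : digit (2 * k) (U ||| r.vec) (code x) = 0) :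
        ∀ y ∈ Submodule.span (ZMod (2 ^ k)) {e} ⊔ N, y x = 0 := by
      rw [digit_or_eq_zero_iff, hdigit, ZMod.val_eq_zero] at hx
      have hle : Submodule.span (ZMod (2 ^ k)) {e} ⊔ N ≤ LinearMap.ker (LinearMap.proj x) :=
        sup_le ((Submodule.span_singleton_le_iff_mem _ _).2 hx.2) (hN x hx.1)
      exact hle
    rw [rowSpan_cons he, ← sup_assoc, sup_comm N, ih hE hspan hech, echelonWeight, pow_add,
      mul_assoc, card_span_singleton_sup hlevel.le hdvd hunit (hN _ hzero)]

end RowSpan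

section Elimination

variable {k n : ℕ} {g : BoolFn n}

theorem lt_and_and_eq_of_testBit_submaskBits {C i S : ℕ} (h : (submaskBits C i).testBit S = true) :
    S < 2 ^ i ∧ S &&& C = S := by
  induction i generalizing S with
  | zero =>
    rw [submaskBits, Nat.testBit_one_eq_true_iff_self_eq_zero] at h
    simp [h]
  | succ i ih =>
    have hpow : 2 ^ i < 2 ^ (i + 1) := Nat.pow_lt_pow_succ one_lt_two
    rw [submaskBits, force_eq] at h
    cases hi : C.testBit i with
    | false => exact (ih (by simpa [hi] using h)).imp_left hpow.trans'
    | true =>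
      simp only [hi, cond_true, Nat.testBit_or, Nat.testBit_shiftLeft, Bool.or_eq_true,
        Bool.and_eq_true, decide_eq_true_eq] at h
      obtain h | ⟨hle, h⟩ := h
      · exact (ih h).imp_left hpow.trans'
      obtain ⟨S, rfl⟩ := Nat.exists_eq_add_of_le hle
      rw [Nat.add_sub_cancel_left] at h
      obtain ⟨hlt, hand⟩ := ih h
      refine ⟨by omega, ?_⟩
      have hor : 2 ^ i + S = 2 ^ i ||| S := by simpa using Nat.two_pow_add_eq_or_of_lt hlt 1
      rw [hor, Nat.and_or_distrib_right, hand, Nat.two_pow_and, hi, Bool.toNat_true, mul_one]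

theorem exists_tag_eq_of_testBit_tagBits {E : List EchelonRow} {S : ℕ}
    (h : (tagBits E).testBit S = true) : ∃ r ∈ E, r.tag = S := by
  induction E with
  | nil => simp [tagBits] at h
  | cons r E ih =>
    rw [tagBits, Nat.testBit_or, Bool.or_eq_true, Nat.testBit_two_pow] at h
    simp only [List.mem_cons, exists_eq_or_imp]
    exact h.symm.imp of_decide_eq_true ih

theorem forceRows_eq {α : Type} (E : List EchelonRow) (f : List EchelonRow → α) :
    forceRows E f = f E := by
  cases E <;> rfl

/-- The row is the table of a vector in the module of its tag. -/
def EchelonRow.IsOf (k : ℕ) (g : BoolFn n) (r : EchelonRow) : Prop :=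
  ∃ e ∈ tailModule k g r.tag, r.vec = table (2 * k) e

theorem EchelonRow.exists_reduce_table (hk : 0 < k) (C : ℕ) {r : EchelonRow}
    {e : (Fin n → ZMod 2) → ZMod (2 ^ k)} (he : e ∈ tailModule k g r.tag)
    (hvec : r.vec = table (2 * k) e) (u : (Fin n → ZMod 2) → ZMod (2 ^ k)) :
    ∃ c : ZMod (2 ^ k), c • e ∈ tailModule k g (C + 1) ∧
      r.reduce (2 ^ k) (repunit (2 * k) (2 ^ n) * (2 ^ k - 1)) C (table (2 * k) u) =
        table (2 * k) (u + c • e) := by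
  rw [reduce, hvec]
  generalize hc : ((Nat.shiftRight _ r.bit).mul r.negUnit).mod (2 ^ k) = c
  have hlt : c < 2 ^ k := hc ▸ Nat.mod_lt _ (Nat.two_pow_pos k)
  cases c with
  | zero => exact ⟨0, by simp, by simp⟩
  | succ c =>
    cases htag : r.tag.ble C with
    | true =>
      have heven : c.succ.sub (c.succ.mod 2) = 2 * (c.succ / 2) :=
        Nat.sub_eq_of_eq_add (Nat.div_add_mod c.succ 2).symm
      refine ⟨(2 * (c.succ / 2) : ℕ), ?_, ?_⟩
      · rw [Nat.cast_mul]
        exact two_mul_smul_mem_tailModule (tailModule_le_translateModule _ he) _ _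
      · rw [← table_add_smul hk ((Nat.mul_div_le _ _).trans_lt hlt), ← heven]
        rfl
    | false =>
      refine ⟨(c.succ : ℕ), Submodule.smul_mem _ _ (tailModule_antitone ?_ he), ?_⟩
      · exact Nat.lt_of_not_le fun h => by simp [Nat.ble_eq_true_of_le h] at htag
      · rw [← table_add_smul hk hlt]
        rfl

theorem exists_reduceRows_table (hk : 0 < k) (C : ℕ) {E : List EchelonRow}
    (hE : ∀ r ∈ E, r.IsOf k g) (u : (Fin n → ZMod 2) → ZMod (2 ^ k)) :
    ∃ d ∈ rowSpan k n E ⊓ tailModule k g (C + 1),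
      reduceRows (2 ^ k) (repunit (2 * k) (2 ^ n) * (2 ^ k - 1)) C E (table (2 * k) u) =
        table (2 * k) (u + d) := by
  induction E with
  | nil => exact ⟨0, zero_mem _, by rw [add_zero, reduceRows]⟩
  | cons r E ih =>
    rw [List.forall_mem_cons] at hE
    obtain ⟨⟨e, he, hvec⟩, hE⟩ := hE
    obtain ⟨d, ⟨hdE, hdC⟩, hd⟩ := ih hE
    obtain ⟨c, hc, hreduce⟩ := r.exists_reduce_table hk C he hvec (u + d)
    refine ⟨d + c • e, ⟨?_, add_mem hdC hc⟩, ?_⟩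
    · exact add_mem (rowSpan_mono (List.subset_cons_self r E) hdE)
        (Submodule.smul_mem _ _ (mem_rowSpan List.mem_cons_self hvec))
    · rw [← add_assoc, ← hreduce, ← hd]
      exact force_eq _ _

theorem table_translateVec_zero (hk : 0 < k) (w : ℕ) (g : BoolFn n) :
    table w (translateVec (2 ^ k) g 0) = table w g := by
  refine pack_congr fun j _ => ?_
  rw [translateVec, add_zero]
  exact ZMod.val_cast_of_lt ((ZMod.val_lt _).trans_le (Nat.le_self_pow hk.ne' 2))

theorem translateTable_table_eq (hk : 0 < k) (g : BoolFn n) {S : ℕ} (hS : S < 2 ^ n) :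
    translateTable (2 * k) n S n (table (2 * k) g) =
      table (2 * k) (translateVec (2 ^ k) g (point n S)) := by
  rw [← table_translateVec_zero hk,
    translateTable_table (two_pow_le_two_pow_two_mul k) (by omega) _ hS]
  simp only [translateVec, add_zero]
  rfl

/-- The state of the elimination at level `l` when the codes `≥ C` have been processed: the rows
come from translates of `g` that they generate and, at the last level, the translate by a code that
is processed or indicated by `done` is generated by the rows or expressible by later ones. -/
structure EliminationState (k l : ℕ) (g : BoolFn n) (C done : ℕ) (E : List EchelonRow) : Prop where
  isOf : ∀ r ∈ E, r.IsOf k g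
  tag_mem : ∀ r ∈ E, translateVec (2 ^ k) g (point n r.tag) ∈ rowSpan k n E
  mem_or_mem : l + 1 = k → ∀ S < 2 ^ n, C ≤ S ∨ done.testBit S = true →
    translateVec (2 ^ k) g (point n S) ∈ rowSpan k n E ∨
      translateVec (2 ^ k) g (point n S) ∈ tailModule k g (S + 1)

namespace EliminationState

variable {l C done : ℕ} {E : List EchelonRow}

theorem skip (h : EliminationState k l g (C + 1) done E) (hC : done.testBit C = true) :
    EliminationState k l g C done E where
  isOf := h.isOf
  tag_mem := h.tag_mem
  mem_or_mem hl S hS hCS := h.mem_or_mem hl S hS <| hCS.elim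
    (fun hCS => hCS.eq_or_lt.elim (fun hCS => Or.inr (hCS ▸ hC)) Or.inl) Or.inr

theorem drop (h : EliminationState k l g (C + 1) done E) (hC : C < 2 ^ n)
    (hmem : l + 1 = k → translateVec (2 ^ k) g (point n C) ∈ tailModule k g (C + 1)) :
    EliminationState k l g C (done ||| submaskBits C n) E where
  isOf := h.isOf
  tag_mem := h.tag_mem
  mem_or_mem hl S hS hCS := by
    rw [Nat.testBit_or, Bool.or_eq_true] at hCS
    obtain hCS | hdone | hsub := hCS
    · obtain rfl | hCS := hCS.eq_or_lt
      · exact Or.inr (hmem hl)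
      · exact h.mem_or_mem hl S hS (Or.inl hCS)
    · exact h.mem_or_mem hl S hS (Or.inr hdone)
    · exact Or.inr (translateVec_mem_tailModule_of_and_eq hC
        (lt_and_and_eq_of_testBit_submaskBits hsub).2 (hmem hl))

theorem push (h : EliminationState k l g (C + 1) done E) (hC : C < 2 ^ n)
    {d : (Fin n → ZMod 2) → ZMod (2 ^ k)} (hdE : d ∈ rowSpan k n E)
    (hdC : d ∈ tailModule k g (C + 1)) {r : EchelonRow} (htag : r.tag = C)
    (hvec : r.vec = table (2 * k) (translateVec (2 ^ k) g (point n C) + d)) :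
    EliminationState k l g C done (r :: E) := by
  have hmono := rowSpan_mono (k := k) (n := n) (List.subset_cons_self r E)
  have hmem : translateVec (2 ^ k) g (point n C) ∈ rowSpan k n (r :: E) := by
    simpa using sub_mem (mem_rowSpan List.mem_cons_self hvec) (hmono hdE)
  have hCtail : translateVec (2 ^ k) g (point n C) + d ∈ tailModule k g C :=
    add_mem (translateVec_mem_tailModule (code_point hC).ge) (tailModule_antitone C.le_succ hdC)
  refine ⟨List.forall_mem_cons.2 ⟨⟨_, htag ▸ hCtail, hvec⟩, h.isOf⟩,
    List.forall_mem_cons.2 ⟨htag ▸ hmem, fun s hs => hmono (h.tag_mem s hs)⟩,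
    fun hl S hS hCS => ?_⟩
  rcases eq_or_ne C S with rfl | hne
  · exact Or.inl hmem
  · exact (h.mem_or_mem hl S hS (hCS.imp_left fun hle => hle.lt_of_ne hne)).imp_left fun hS =>
      hmono hS

theorem addRows (hk : 0 < k) (hl : l < k) (hC : C ≤ 2 ^ n)
    (h : EliminationState k l g C done E) :
    ∃ done', EliminationState k l g 0 done'
      (addRows k n l (repunit (2 * k) (2 ^ n)) (table (2 * k) g) C done E) := by
  induction C generalizing done E with
  | zero => exact ⟨done, h⟩
  | succ C ih =>
    have ih {done E} := @ih done E (Nat.le_of_succ_le hC)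
    obtain ⟨d, ⟨hdE, hdC⟩, hd⟩ :=
      exists_reduceRows_table hk C h.isOf (translateVec (2 ^ k) g (point n C))
    rw [_root_.addRows]
    cases hdone : done.testBit C with
    | true => exact ih (h.skip hdone)
    | false =>
      rw [cond_false, force_eq, force_eq, force_eq, force_eq, translateTable_table_eq hk g hC, hd]
      split
      next hzero =>
        rw [force_eq]
        refine ih (h.drop hC fun hlk => ?_)
        rw [table_and_repunit_mul_eq_zero_iff hk hl, Nat.succ_eq_add_one, hlk] at hzero
        have hsum : translateVec (2 ^ k) g (point n C) + d = 0 := funext fun x =>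
          (ZMod.val_eq_zero _).1 (Nat.eq_zero_of_dvd_of_lt (hzero x) (ZMod.val_lt _))
        exact eq_neg_of_add_eq_zero_left hsum ▸ neg_mem hdC
      next =>
        rw [force_eq, force_eq]
        exact ih (h.push hC hdE hdC rfl rfl)

theorem start {l' : ℕ} (h : EliminationState k l g 0 done E) :
    EliminationState k l' g (2 ^ n) (tagBits E) E where
  isOf := h.isOf
  tag_mem := h.tag_mem
  mem_or_mem _ S hS hCS := by
    obtain ⟨r, hr, rfl⟩ := exists_tag_eq_of_testBit_tagBits (hCS.resolve_left hS.not_ge)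
    exact Or.inl (h.tag_mem r hr)

theorem rowSpan_eq_translateModule (hl : l + 1 = k) (h : EliminationState k l g 0 done E) :
    rowSpan k n E = translateModule (2 ^ k) g := by
  refine le_antisymm (Submodule.span_le.2 ?_) (translateModule_le_of_forall_mem_tailModule
    fun S hS => h.mem_or_mem hl S hS (Or.inl S.zero_le))
  rintro e ⟨r, hr, he⟩
  obtain ⟨e', he', hvec⟩ := h.isOf r hr
  rw [he, (table_injective (two_pow_le_two_pow_two_mul k)).eq_iff] at hvec
  exact hvec ▸ tailModule_le_translateModule _ he'

end EliminationState

theorem eliminationState_echelonRows (hk : 0 < k) (g : BoolFn n) {l : ℕ} (hl : l < k) :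
    ∃ done, EliminationState k l g 0 done
      (echelonRows k n (repunit (2 * k) (2 ^ n)) (table (2 * k) g) (l + 1)) := by
  rw [echelonRows, forceRows_eq, force_eq]
  refine EliminationState.addRows hk hl le_rfl ?_
  cases l with
  | zero => exact ⟨by simp [echelonRows], by simp [echelonRows], fun _ S hS hCS =>
      by simp [tagBits, echelonRows, hS.not_ge] at hCS⟩
  | succ l =>
    obtain ⟨done, h⟩ := eliminationState_echelonRows hk g (Nat.lt_of_succ_lt hl)
    exact h.start

theorem card_translateModule_of_translateModuleCheck (hk : 0 < k) {W : ℕ}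
    (h : translateModuleCheck k n W (table (2 * k) g) = true) :
    Nat.card (translateModule (2 ^ k) g) = 2 ^ W := by
  obtain ⟨l, rfl⟩ : ∃ l, k = l + 1 := ⟨k - 1, (Nat.succ_pred_eq_of_pos hk).symm⟩
  obtain ⟨done, hE⟩ := eliminationState_echelonRows hk g l.lt_succ_self
  simp only [translateModuleCheck, force_eq, forceRows_eq, Bool.and_eq_true, Nat.beq_eq] at h
  have hcard := card_sup_rowSpan_of_isEchelon hk
    (fun r hr => (hE.isOf r hr).imp fun _ he => he.2) (N := ⊥) (fun x _ y hy => by simp_all) h.1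
  rw [bot_sup_eq, hE.rowSpan_eq_translateModule rfl, h.2] at hcard
  simpa using hcard

end Elimination

section GraphTable

/-- The table of the indicator function of the graph of `cubicOf L`. -/
def graphTable (w : ℕ) {n : ℕ} (L : List (Fin n × Fin n × Fin n)) : ℕ :=
  cubicTable w (n + 1) L ^^^ varTable w (n + 1) n ^^^ repunit w (2 ^ (n + 1))

theorem graphTable_eq_table {w n : ℕ} (hw : 0 < w) (L : List (Fin n × Fin n × Fin n)) :
    graphTable w L = table w (graphIndicator (cubicOf L)) := by
  have hvar := varTable_eq_table hw (Fin.last n)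
  rw [Fin.val_last] at hvar
  rw [graphTable, cubicTable_eq_table hw n.le_succ, hvar, repunit_eq_table hw, ← table_add hw,
    ← table_add hw]
  rfl

theorem card_translateModule_graphIndicator_cubicOf {k n W : ℕ} (hk : 0 < k)
    {L : List (Fin n × Fin n × Fin n)}
    (h : translateModuleCheck k (n + 1) W (graphTable (2 * k) L) = true) :
    Nat.card (translateModule (2 ^ k) (graphIndicator (cubicOf L))) = 2 ^ W := by
  rw [graphTable_eq_table (by omega)] at h
  exact card_translateModule_of_translateModuleCheck hk h

end GraphTable

theorem isHomogeneousFn_h12 (i : Fin 7) : IsHomogeneousFn 3 (h12 i) := by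
  fin_cases i <;> exact isHomogeneousFn_cubicOf_of_all (by decide +kernel)

set_option maxRecDepth 100000 in
set_option maxHeartbeats 1000000 in
-- Each of the seven functions has 4095 derivatives, all of which the kernel evaluates.
theorem isBent_h12 (i : Fin 7) : IsBent (h12 i) := by
  fin_cases i <;> exact isBent_cubicOf (by decide +kernel)

set_option maxRecDepth 100000 in
theorem not_equivalentFn_h12_of_isPrimary (i : Fin 7) {h : BoolFn 12} (hp : IsPrimary 6 h) :
    ¬EquivalentFn (h12 i) h := by
  fin_cases i <;> exact not_equivalentFn_cubicOf_of_isPrimary (m := 6) (by decide +kernel) hp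

theorem isGaussJordan_basis :
    IsGaussJordan
      (Matrix.of fun i : Fin 6 => point 12 (![3, 132, 264, 528, 1056, 2112] i : Fin (2 ^ 12)))
      ![0, 2, 3, 4, 5, 6] := by
  have hleading (i : Fin 6) (k : Fin 12) (h : k < (![0, 2, 3, 4, 5, 6] : Fin 6 → Fin 12) i) :
      point 12 (![3, 132, 264, 528, 1056, 2112] i : Fin (2 ^ 12)) k = 0 := by
    decide +kernel +revert
  refine ⟨fun i j => ?_, ?_, hleading⟩ <;> decide +kernel +revert

theorem strictMono_complement : StrictMono (![1, 7, 8, 9, 10, 11] : Fin 6 → Fin 12) := by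
  intro i j
  decide +revert

theorem range_complement : Set.range (![1, 7, 8, 9, 10, 11] : Fin 6 → Fin 12) =
    (Set.range (![0, 2, 3, 4, 5, 6] : Fin 6 → Fin 12))ᶜ := by
  ext k
  simp only [Set.mem_compl_iff, Set.mem_range]
  decide +revert

set_option maxRecDepth 100000 in
theorem h12_6_mem_newFromOld : h12_6 ∈ newFromOld 6 6 3 h12_3 :=
  cubicOf_mem_newFromOld rfl (isHomogeneousFn_h12 5) (isBent_h12 5) isGaussJordan_basis
    strictMono_complement range_complement one_pos (by decide +kernel)

set_option maxRecDepth 100000 in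
theorem h12_7_mem_newFromOld : h12_7 ∈ newFromOld 6 6 3 h12_3 :=
  cubicOf_mem_newFromOld rfl (isHomogeneousFn_h12 6) (isBent_h12 6) isGaussJordan_basis
    strictMono_complement range_complement one_pos (by decide +kernel)

set_option maxRecDepth 100000 in
theorem card_translateModule_four_h12 (i : Fin 7) :
    Nat.card (translateModule (2 ^ 2) (graphIndicator (h12 i))) =
      2 ^ (![186, 170, 175, 148, 248, 171, 171] i : ℕ) := by
  fin_cases i <;> exact card_translateModule_graphIndicator_cubicOf two_pos (by decide +kernel)

set_option maxRecDepth 100000 in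
theorem card_translateModule_eight_h12_6_h12_7 :
    Nat.card (translateModule (2 ^ 3) (graphIndicator h12_6)) = 2 ^ 610 ∧
      Nat.card (translateModule (2 ^ 3) (graphIndicator h12_7)) = 2 ^ 590 :=
  ⟨card_translateModule_graphIndicator_cubicOf three_pos (by decide +kernel),
    card_translateModule_graphIndicator_cubicOf three_pos (by decide +kernel)⟩

theorem injective_snf_h12 : Function.Injective fun i => snf (h12 i) := by
  intro i j hij
  have hcard (q : ℕ) : Nat.card (translateModule q (graphIndicator (h12 i))) =
      Nat.card (translateModule q (graphIndicator (h12 j))) := by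
    rw [card_translateModule_eq_prod_snf, card_translateModule_eq_prod_snf]
    exact congrArg _ (congrArg _ hij)
  have hfour := hcard (2 ^ 2)
  rw [card_translateModule_four_h12, card_translateModule_four_h12] at hfour
  have hcases : i = j ∨ i = 5 ∧ j = 6 ∨ i = 6 ∧ j = 5 := by
    have hexp := Nat.pow_right_injective le_rfl hfour
    clear hij hcard hfour
    decide +revert
  have hne : Nat.card (translateModule (2 ^ 3) (graphIndicator h12_6)) ≠
      Nat.card (translateModule (2 ^ 3) (graphIndicator h12_7)) := by
    rw [card_translateModule_eight_h12_6_h12_7.1, card_translateModule_eight_h12_6_h12_7.2]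
    norm_num
  rcases hcases with h | ⟨rfl, rfl⟩ | ⟨rfl, rfl⟩
  · exact h
  · exact absurd (hcard (2 ^ 3)) hne
  · exact absurd (hcard (2 ^ 3)).symm hne

theorem mainTheorem4 :
    (∀ i, IsHomogeneousFn 3 (h12 i) ∧ IsBent (h12 i)) ∧
    (∀ i j, i ≠ j → ¬ EquivalentFn (h12 i) (h12 j)) ∧
    (∀ i, ∀ h : BoolFn 12, IsPrimary 6 h → ¬ EquivalentFn (h12 i) h) ∧
    (h12_6 ∈ newFromOld 6 6 3 h12_3 ∧ h12_7 ∈ newFromOld 6 6 3 h12_3) ∧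
    (∀ i, i ≠ 5 → snf (h12 i) ≠ snf (h12 5)) ∧
    (∀ i, i ≠ 6 → snf (h12 i) ≠ snf (h12 6)) :=
  ⟨fun i => ⟨isHomogeneousFn_h12 i, isBent_h12 i⟩,
    fun _ _ hij h => hij (injective_snf_h12 h.snf_eq),
    fun i _ hp => not_equivalentFn_h12_of_isPrimary i hp,
    ⟨h12_6_mem_newFromOld, h12_7_mem_newFromOld⟩,
    fun _ hi h => hi (injective_snf_h12 h),
    fun _ hi h => hi (injective_snf_h12 h)⟩
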